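/- Let $n\ge 0$ be an integer, let $B_2^n$ be the closed Euclidean unit ball of $\mathbb{R}^n$. A *symmetric convex body* is a compact convex set $A\subset\mathbb{R}^n$ with nonempty interior and $A=-A$. A probability measure $\mu$ on $\mathbb{R}^n$ is *log-concave* if it has a density $f:\mathbb{R}^n\to[0,\infty)$ with respect to Lebesgue measure such that $f(\tau x+(1-\tau)y)\ge f(x)^{\tau}f(y)^{1-\tau}$ for all $x,y\in\mathbb{R}^n$ and $\tau\in[0,1]$, and it is *isotropic* if it has finite second moments, its barycenter is at the origin and its covariance matrix is the identity. The $\mu$-perimeter of $A$ is $$\mu^+(\partial A)=\liminf_{\epsilon\to 0^+}\frac{\mu\big((A+\epsilon B_2^n)\setminus A\big)}{\epsilon}\in[0,\infty].$$ Put $$\Gamma^{(s)}(\mu)=\sup\{\mu^+(\partial A): A\subset\mathbb{R}^n \text{ is a symmetric convex body}\},$$ $$\Gamma_n^{(s)}=\sup\{\Gamma^{(s)}(\mu):\mu \text{ is an isotropic log-concave probability measure on }\mathbb{R}^n\}.$$ **Theorem.** For every isotropic log-concave probability measure $\mu$ on $\mathbb{R}^n$ and every symmetric convex body $A\subset\mathbb{R}^n$,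 $$\mu^+(\partial A)\le 4n .$$ Consequently, $\Gamma_n^{(s)}\le 4n$. -/

import Mathlib

open MeasureTheory ProbabilityTheory Filter Topology Set
open scoped ENNReal Pointwise

noncomputable section

/-- A convex body in `ℝⁿ`: a compact convex set with nonempty interior.
(Mathlib's `ConvexBody` does not ask for interior points.) -/
structure IsFullConvexBody {n : ℕ} (A : Set (EuclideanSpace ℝ (Fin n))) : Prop where
  convex : Convex ℝ A
  isCompact : IsCompact A
  interior_nonempty : (interior A).Nonempty

/-- A convex body `A` with `A = -A`. -/
structure IsSymmetricConvexBody {n : ℕ} (A : Set (EuclideanSpace ℝ (Fin n))) : Prop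
    extends IsFullConvexBody A where
  neg_eq : -A = A

/-- `μ` has a log-concave density with respect to Lebesgue measure. The inequality is the
exponential of `log f (τ x + (1 - τ) y) ≥ τ log f x + (1 - τ) log f y`, with `log 0 = -∞`. -/
def IsLogConcaveMeasure {n : ℕ} (μ : Measure (EuclideanSpace ℝ (Fin n))) : Prop :=
  ∃ f : EuclideanSpace ℝ (Fin n) → ℝ,
    AEMeasurable f volume ∧ (∀ x, 0 ≤ f x) ∧
    (∀ x y, ∀ τ ∈ Icc (0 : ℝ) 1,
      f x ^ τ * f y ^ (1 - τ) ≤ f (τ • x + (1 - τ) • y)) ∧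
    μ = volume.withDensity (fun x => ENNReal.ofReal (f x))

/-- The covariance matrix of `μ`. -/
def covMatrix {n : ℕ} (μ : Measure (EuclideanSpace ℝ (Fin n))) : Matrix (Fin n) (Fin n) ℝ :=
  Matrix.of fun i j => cov[fun x => x i, fun x => x j; μ]

/-- Finite second moments, barycenter at the origin, and covariance matrix equal to the
identity. -/
structure IsIsotropicMeasure {n : ℕ} (μ : Measure (EuclideanSpace ℝ (Fin n))) : Prop where
  memLp : MemLp (fun x : EuclideanSpace ℝ (Fin n) => x) 2 μ
  barycenter_eq_zero : ∫ x, x ∂μ = 0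
  covMatrix_eq_one : covMatrix μ = 1

/-- Isotropic log-concave probability measures on `ℝⁿ`. -/
structure IsIsotropicLogConcaveProb {n : ℕ} (μ : Measure (EuclideanSpace ℝ (Fin n))) : Prop where
  isProbabilityMeasure : IsProbabilityMeasure μ
  isLogConcave : IsLogConcaveMeasure μ
  isIsotropic : IsIsotropicMeasure μ

/-- The `μ`-perimeter `μ⁺(∂A) = liminf_{ε → 0⁺} μ((A + ε B) \ A) / ε`, where `B` is the closed
Euclidean unit ball. -/
def muPerimeter {n : ℕ} (μ : Measure (EuclideanSpace ℝ (Fin n)))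
    (A : Set (EuclideanSpace ℝ (Fin n))) : ℝ≥0∞ :=
  liminf (fun ε : ℝ =>
    μ ((A + ε • Metric.closedBall (0 : EuclideanSpace ℝ (Fin n)) 1) \ A) / ENNReal.ofReal ε)
    (𝓝[>] 0)

/-- `Γ⁽ˢ⁾(μ)`: the supremum of the `μ`-perimeters of symmetric convex bodies. -/
def symmMaxPerimeter {n : ℕ} (μ : Measure (EuclideanSpace ℝ (Fin n))) : ℝ≥0∞ :=
  ⨆ (A : Set (EuclideanSpace ℝ (Fin n))) (_ : IsSymmetricConvexBody A), muPerimeter μ A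

/-- `Γₙ⁽ˢ⁾`: the supremum of `Γ⁽ˢ⁾(μ)` over isotropic log-concave probability measures on `ℝⁿ`. -/
def symmMaxPerimeterConst (n : ℕ) : ℝ≥0∞ :=
  ⨆ (μ : Measure (EuclideanSpace ℝ (Fin n))) (_ : IsIsotropicLogConcaveProb μ), symmMaxPerimeter μ

end

/-! Let `M` be the supremum of the density `f`, let `ψ = log M - log f`, and let `κ` be the `μ`-mean
of `ψ`. The bound rests on two facts: `κ ≤ n`, and `f ≥ M exp(-2κ)` on the open ball of radius
`1/2`.

The first (`IsRegularLogConcave.exists_bound_potential`) comes from integrating `f(x)^(1-t) f(y)^t ≤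
f((1-t)x + ty)` in `x` and taking the supremum over `y`. This gives `E exp(tψ) ≤ (1-t)^(-n)`, and
the first-order terms at `t = 0` are compared.

For the second (`IsRegularLogConcave.exp_le_of_norm_lt`), failure at `m` yields a hyperplane
separating a point above `m` from the hypograph of `log f`, so a linear functional `ℓ` is controlled
by `ψ`. Integrate this over the half-space beyond the median of `ℓ`. There `ψ` contributes at most
`κ`, while `ℓ` contributes at least a quarter of its norm
(`PrekopaLeindler.exists_halfspace_integral_ge`, through log-concavity of tails). This forces `‖m‖ ≥
1/2`.

Now take `ε = rδ` with `r < 1/2`. Concavity of `log f` and the lower bound near the origin give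
`f(x) ≤ F(y)` whenever `‖x - y‖ ≤ ε`, where `F(y) = f(q) exp(δ(2κ - ψ(q)))` and `q = y/(1+δ)`.
Pushing the complement of `A` outward by `ε` does not decrease distances, so `1 + μ(shell) ≤ ∫ F`.
Rescaling bounds `∫ F` by `1 + δ(n + κ) + O(δ²)`. Dividing by `ε` and letting first `ε → 0`, then `r
→ 1/2`, gives `2(n + κ) ≤ 4n`. -/

/-! ### The Prékopa-Leindler inequality. -/

/-- The one-dimensional Brunn-Minkowski inequality for compact sets. -/
lemma Real.volume_add_le_of_isCompact {A B C : Set ℝ} (hA : IsCompact A) (hB : IsCompact B)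
    (hA' : A.Nonempty) (hB' : B.Nonempty) (hC : ∀ x ∈ A, ∀ y ∈ B, x + y ∈ C) :
    volume A + volume B ≤ volume C := by
  obtain ⟨M, hM⟩ := hA.exists_isGreatest hA'
  obtain ⟨m, hm⟩ := hB.exists_isLeast hB'
  have h1 : volume ((fun x => m + x) '' A) = volume A := by simp [measure_preimage_add]
  have h2 : volume ((fun x => M + x) '' B) = volume B := by simp [measure_preimage_add]
  -- The translate `m + A` lies to the left of `M + m` and `M + B` to its right, so they share at
  -- most that point.
  have hd : AEDisjoint volume ((fun x => m + x) '' A) ((fun x => M + x) '' B) := by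
    refine measure_mono_null (t := {M + m}) ?_ (by simp)
    rintro _ ⟨⟨x, hx, rfl⟩, y, hy, hxy⟩
    have := hM.2 hx
    have := hm.2 hy
    simp only [mem_singleton_iff] at hxy ⊢
    linarith
  rw [← h1, ← h2, ← measure_union₀ _ hd]
  · refine measure_mono ?_
    rintro _ (⟨x, hx, rfl⟩ | ⟨x, hx, rfl⟩)
    · simpa only [add_comm m x] using hC x hx m hm.1
    · exact hC M hM.1 x hx
  · exact (hB.image (by fun_prop)).measurableSet.nullMeasurableSet

/-- The one-dimensional Brunn-Minkowski inequality. -/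
lemma Real.volume_add_le {A B C : Set ℝ} (hA : MeasurableSet A) (hB : MeasurableSet B)
    (hA' : A.Nonempty) (hB' : B.Nonempty) (hC : ∀ x ∈ A, ∀ y ∈ B, x + y ∈ C) :
    volume A + volume B ≤ volume C := by
  obtain ⟨x₀, hx₀⟩ := hA'
  obtain ⟨y₀, hy₀⟩ := hB'
  by_cases hA0 : volume A = 0
  · rw [hA0, zero_add]
    calc volume B = volume ((fun y => x₀ + y) '' B) := by simp [measure_preimage_add]
      _ ≤ _ := measure_mono (by rintro _ ⟨y, hy, rfl⟩; exact hC _ hx₀ _ hy)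
  by_cases hB0 : volume B = 0
  · rw [hB0, add_zero]
    calc volume A = volume ((fun x => x + y₀) '' A) := by simp [measure_preimage_add_right]
      _ ≤ _ := measure_mono (by rintro _ ⟨x, hx, rfl⟩; exact hC _ hx _ hy₀)
  refine le_of_forall_lt fun r hr => ?_
  obtain ⟨s, hs, t, ht, hst⟩ := ENNReal.exists_lt_add_of_lt_add hr hA0 hB0
  obtain ⟨K, hKA, hK, hsK⟩ := hA.exists_lt_isCompact hs
  obtain ⟨K', hKB, hK', htK⟩ := hB.exists_lt_isCompact ht
  refine hst.trans_le ((add_le_add hsK.le htK.le).trans ?_)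
  exact Real.volume_add_le_of_isCompact hK hK' (nonempty_of_measure_ne_zero (bot_le.trans_lt hsK).ne')
    (nonempty_of_measure_ne_zero (bot_le.trans_lt htK).ne')
    fun x hx y hy => hC x (hKA hx) y (hKB hy)

lemma ENNReal.geom_mean_le_arith_mean {a b : ℝ} (ha : 0 < a) (hb : 0 < b) (hab : a + b = 1)
    (x y : ℝ≥0∞) : x ^ a * y ^ b ≤ ENNReal.ofReal a * x + ENNReal.ofReal b * y := by
  have ha' : ENNReal.ofReal a ≠ 0 := by simpa using ha
  have hb' : ENNReal.ofReal b ≠ 0 := by simpa using hb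
  rcases eq_or_ne x ∞ with rfl | hx
  · simp [ENNReal.mul_top ha']
  rcases eq_or_ne y ∞ with rfl | hy
  · simp [ENNReal.mul_top hb']
  lift x to NNReal using hx
  lift y to NNReal using hy
  lift a to NNReal using ha.le
  lift b to NNReal using hb.le
  have := NNReal.geom_mean_le_arith_mean2_weighted a b x y (by exact_mod_cast hab)
  rw [← ENNReal.coe_rpow_of_nonneg _ ha.le, ← ENNReal.coe_rpow_of_nonneg _ hb.le]
  simp only [ENNReal.ofReal_coe_nnreal]
  exact_mod_cast this

lemma ENNReal.iSup_rpow_mul_iSup_rpow_le {a b : ℝ} (ha : 0 < a) (hb : 0 < b) {A B : ℕ → ℝ≥0∞}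
    {C : ℝ≥0∞} (hA : Monotone A) (hB : Monotone B) (h : ∀ k, A k ^ a * B k ^ b ≤ C) :
    (⨆ k, A k) ^ a * (⨆ k, B k) ^ b ≤ C := by
  have e1 : (⨆ k, A k) ^ a = ⨆ k, A k ^ a := (ENNReal.orderIsoRpow a ha).map_iSup A
  have e2 : (⨆ k, B k) ^ b = ⨆ k, B k ^ b := (ENNReal.orderIsoRpow b hb).map_iSup B
  rw [e1, e2, ENNReal.iSup_mul]
  refine iSup_le fun i => ?_
  rw [ENNReal.mul_iSup]
  refine iSup_le fun j => le_trans ?_ (h (max i j))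
  gcongr
  · exact hA (le_max_left _ _)
  · exact hB (le_max_right _ _)

/-- Layer-cake form of one-dimensional Brunn-Minkowski. Since `u` and `v` both have supremum one,
their superlevel sets are nonempty at every level below one and empty from one on, so the set
inequality applies level by level. -/
lemma Real.lintegral_add_le_of_superlevel {a b : ℝ} (ha : 0 < a) (hb : 0 < b)
    {u v w : ℝ → ℝ} (hu : Measurable u) (hv : Measurable v) (hw : Measurable w)
    (hu0 : ∀ x, 0 ≤ u x) (hv0 : ∀ x, 0 ≤ v x) (hw0 : ∀ x, 0 ≤ w x)
    (hu1 : ∀ x, u x ≤ 1) (hv1 : ∀ x, v x ≤ 1)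
    (hus : ∀ τ < 1, ∃ x, τ < u x) (hvs : ∀ τ < 1, ∃ x, τ < v x)
    (h : ∀ τ x y, 0 < τ → τ < u x → τ < v y → τ < w (a * x + b * y)) :
    ENNReal.ofReal a * (∫⁻ x, ENNReal.ofReal (u x)) + ENNReal.ofReal b *
      (∫⁻ x, ENNReal.ofReal (v x)) ≤ ∫⁻ x, ENNReal.ofReal (w x) := by
  rw [lintegral_eq_lintegral_meas_lt _ (.of_forall hu0) hu.aemeasurable,
    lintegral_eq_lintegral_meas_lt _ (.of_forall hv0) hv.aemeasurable,
    lintegral_eq_lintegral_meas_lt _ (.of_forall hw0) hw.aemeasurable,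
    ← lintegral_const_mul', ← lintegral_const_mul', ← lintegral_add_left']
  rotate_left
  · exact (Antitone.measurable (fun s t hst => by
      gcongr)).aemeasurable
  · exact ENNReal.ofReal_ne_top
  · exact ENNReal.ofReal_ne_top
  refine setLIntegral_mono' measurableSet_Ioi fun τ hτ => ?_
  rcases lt_or_ge τ 1 with h1 | h1
  · have e : ∀ (c : ℝ) (_ : 0 < c) (s : Set ℝ), ENNReal.ofReal c * volume s = volume (c • s) := by
      intro c hc s
      rw [Measure.addHaar_smul]; simp [abs_of_pos hc]
    rw [e a ha, e b hb]
    refine Real.volume_add_le ?_ ?_ ?_ ?_ ?_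
    · exact (measurableSet_lt measurable_const hu).const_smul₀ a
    · exact (measurableSet_lt measurable_const hv).const_smul₀ b
    · exact Set.Nonempty.smul_set (hus τ h1)
    · exact Set.Nonempty.smul_set (hvs τ h1)
    · rintro _ ⟨x, hx, rfl⟩ _ ⟨y, hy, rfl⟩
      exact h τ x y hτ hx hy
  · have e1 : {x | τ < u x} = ∅ := by ext x; simpa using (hu1 x).trans h1
    have e2 : {x | τ < v x} = ∅ := by ext x; simpa using (hv1 x).trans h1
    simp [e1, e2]

/-- The Prékopa-Leindler property of a measure. -/
def PrekopaLeindler {E : Type*} [AddCommGroup E] [Module ℝ E] [MeasurableSpace E]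
    (μ : Measure E) : Prop :=
  ∀ (a b : ℝ), 0 < a → 0 < b → a + b = 1 → ∀ f g h : E → ℝ≥0∞, Measurable f → Measurable g →
    Measurable h → (∀ x y, f x ^ a * g y ^ b ≤ h (a • x + b • y)) →
    (∫⁻ x, f x ∂μ) ^ a * (∫⁻ x, g x ∂μ) ^ b ≤ ∫⁻ x, h x ∂μ

/-- Dividing `f` and `g` by their suprema makes the levels match, which yields the arithmetic-mean
form; the weighted AM-GM inequality then gives the geometric mean, and the normalizing constants
cancel. -/
lemma Real.prekopaLeindler_of_bounded {a b : ℝ} (ha : 0 < a) (hb : 0 < b) (hab : a + b = 1)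
    {f g h : ℝ → ℝ≥0∞} (hf : Measurable f) (hg : Measurable g) (hh : Measurable h)
    (H : ∀ x y, f x ^ a * g y ^ b ≤ h (a • x + b • y)) (hfb : ⨆ x, f x ≠ ∞)
    (hgb : ⨆ x, g x ≠ ∞) :
    (∫⁻ x, f x) ^ a * (∫⁻ x, g x) ^ b ≤ ∫⁻ x, h x := by
  set F := ⨆ x, f x with hF
  set G := ⨆ x, g x with hG
  have hfF : ∀ x, f x ≤ F := le_iSup f
  have hgG : ∀ x, g x ≤ G := le_iSup g
  rcases eq_or_ne F 0 with hF0 | hF0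
  · have : ∀ x, f x = 0 := fun x => by simpa [hF0] using hfF x
    simp [this, ha]
  rcases eq_or_ne G 0 with hG0 | hG0
  · have : ∀ x, g x = 0 := fun x => by simpa [hG0] using hgG x
    simp [this, hb]
  set D := F ^ a * G ^ b with hD
  have hD0 : D ≠ 0 := by simp [hD, hF0, hG0, hfb, hgb]
  have hDt : D ≠ ∞ := by
    exact ENNReal.mul_ne_top (by simp [hfb, hF0]) (by simp [hgb, hG0])
  -- `h` may be infinite; cutting `h / D` at one keeps `toReal` faithful and loses nothing, as only
  -- levels below one matter.
  have key := Real.lintegral_add_le_of_superlevel ha hb (u := fun x => (f x / F).toReal)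
    (v := fun x => (g x / G).toReal) (w := fun x => (min (h x / D) 1).toReal)
    (by fun_prop) (by fun_prop) (by fun_prop) (fun _ => ENNReal.toReal_nonneg)
    (fun _ => ENNReal.toReal_nonneg) (fun _ => ENNReal.toReal_nonneg)
    (fun x => ENNReal.toReal_le_of_le_ofReal zero_le_one (by
      simpa using ENNReal.div_le_of_le_mul (by simpa using hfF x)))
    (fun x => ENNReal.toReal_le_of_le_ofReal zero_le_one (by
      simpa using ENNReal.div_le_of_le_mul (by simpa using hgG x))) ?_ ?_ ?_
  · have e1 : ∀ x, ENNReal.ofReal (f x / F).toReal = F⁻¹ * f x := fun x => by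
      rw [ENNReal.ofReal_toReal, div_eq_mul_inv, mul_comm]
      exact ENNReal.div_ne_top ((hfF x).trans_lt hfb.lt_top).ne hF0
    have e2 : ∀ x, ENNReal.ofReal (g x / G).toReal = G⁻¹ * g x := fun x => by
      rw [ENNReal.ofReal_toReal, div_eq_mul_inv, mul_comm]
      exact ENNReal.div_ne_top ((hgG x).trans_lt hgb.lt_top).ne hG0
    have e3 : ∀ x, ENNReal.ofReal (min (h x / D) 1).toReal ≤ D⁻¹ * h x := fun x => by
      rw [ENNReal.ofReal_toReal (by simp)]
      exact (min_le_left _ _).trans (by rw [div_eq_mul_inv, mul_comm])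
    simp only [e1, e2] at key
    rw [lintegral_const_mul _ hf, lintegral_const_mul _ hg] at key
    have k2 := (ENNReal.geom_mean_le_arith_mean ha hb hab _ _).trans
      (key.trans (lintegral_mono e3))
    rw [lintegral_const_mul _ hh, ENNReal.mul_rpow_of_nonneg _ _ ha.le,
      ENNReal.mul_rpow_of_nonneg _ _ hb.le, mul_mul_mul_comm, ENNReal.inv_rpow, ENNReal.inv_rpow,
      ← ENNReal.mul_inv (by simp [hF0, hfb]) (by simp [hfb, hF0]), ← hD] at k2
    exact (ENNReal.mul_le_mul_iff_right (ENNReal.inv_ne_zero.2 hDt) (ENNReal.inv_ne_top.2 hD0)).1 k2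
  · intro τ hτ
    rcases lt_or_ge τ 0 with h0 | h0
    · exact ⟨0, h0.trans_le ENNReal.toReal_nonneg⟩
    have : ENNReal.ofReal τ * F < F := by
      conv_rhs => rw [← one_mul F]
      exact (ENNReal.mul_lt_mul_iff_left hF0 hfb).2 (by simpa using hτ)
    obtain ⟨x, hx⟩ := lt_iSup_iff.1 this
    refine ⟨x, (ENNReal.ofReal_lt_iff_lt_toReal h0 ?_).1 ?_⟩
    · exact ENNReal.div_ne_top ((hfF x).trans_lt hfb.lt_top).ne hF0
    · exact (ENNReal.lt_div_iff_mul_lt (.inl hF0) (.inl hfb)).2 hx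
  · intro τ hτ
    rcases lt_or_ge τ 0 with h0 | h0
    · exact ⟨0, h0.trans_le ENNReal.toReal_nonneg⟩
    have : ENNReal.ofReal τ * G < G := by
      conv_rhs => rw [← one_mul G]
      exact (ENNReal.mul_lt_mul_iff_left hG0 hgb).2 (by simpa using hτ)
    obtain ⟨x, hx⟩ := lt_iSup_iff.1 this
    refine ⟨x, (ENNReal.ofReal_lt_iff_lt_toReal h0 ?_).1 ?_⟩
    · exact ENNReal.div_ne_top ((hgG x).trans_lt hgb.lt_top).ne hG0
    · exact (ENNReal.lt_div_iff_mul_lt (.inl hG0) (.inl hgb)).2 hx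
  · intro τ x y hτ hx hy
    have hx' := (ENNReal.ofReal_lt_iff_lt_toReal hτ.le
      (ENNReal.div_ne_top ((hfF x).trans_lt hfb.lt_top).ne hF0)).2 hx
    have hy' := (ENNReal.ofReal_lt_iff_lt_toReal hτ.le
      (ENNReal.div_ne_top ((hgG y).trans_lt hgb.lt_top).ne hG0)).2 hy
    rw [← ENNReal.ofReal_lt_iff_lt_toReal hτ.le (by simp)]
    refine lt_min ?_ ?_
    · rw [ENNReal.lt_div_iff_mul_lt (.inl hD0) (.inl hDt)]
      refine lt_of_lt_of_le ?_ (H x y)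
      rw [ENNReal.lt_div_iff_mul_lt (.inl hF0) (.inl hfb)] at hx'
      rw [ENNReal.lt_div_iff_mul_lt (.inl hG0) (.inl hgb)] at hy'
      have e : ENNReal.ofReal τ * D = (ENNReal.ofReal τ * F) ^ a * (ENNReal.ofReal τ * G) ^ b := by
        rw [ENNReal.mul_rpow_of_nonneg _ _ ha.le, ENNReal.mul_rpow_of_nonneg _ _ hb.le,
          mul_mul_mul_comm, ← ENNReal.rpow_add_of_nonneg _ _ ha.le hb.le, hab, ENNReal.rpow_one]
      rw [e]
      exact ENNReal.mul_lt_mul (ENNReal.rpow_lt_rpow hx' ha) (ENNReal.rpow_lt_rpow hy' hb)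
    · exact hx'.trans_le (ENNReal.div_le_of_le_mul (by simpa using hfF x))

lemma lintegral_eq_iSup_min_natCast {E : Type*} [MeasurableSpace E] (μ : Measure E)
    {f : E → ℝ≥0∞} (hf : Measurable f) : ∫⁻ x, f x ∂μ = ⨆ k : ℕ, ∫⁻ x, min (f x) k ∂μ := by
  rw [← lintegral_iSup]
  · congr 1 with x
    rw [← inf_iSup_eq, ENNReal.iSup_natCast, inf_top_eq]
  · intro n; fun_prop
  · intro i j hij x
    exact min_le_min_left _ (by exact_mod_cast hij)

lemma Real.prekopaLeindler : PrekopaLeindler (volume : Measure ℝ) := by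
  intro a b ha hb hab f g h hf hg hh H
  rw [lintegral_eq_iSup_min_natCast _ hf, lintegral_eq_iSup_min_natCast _ hg]
  refine ENNReal.iSup_rpow_mul_iSup_rpow_le ha hb ?_ ?_ fun k => ?_
  · exact fun i j hij => lintegral_mono fun x => min_le_min_left _ (by exact_mod_cast hij)
  · exact fun i j hij => lintegral_mono fun x => min_le_min_left _ (by exact_mod_cast hij)
  have hlt : ∀ f : ℝ → ℝ≥0∞, ⨆ x, min (f x) k ≠ ∞ := fun f =>
    ((iSup_le fun x => min_le_right _ _).trans_lt (ENNReal.natCast_lt_top k)).ne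
  refine Real.prekopaLeindler_of_bounded ha hb hab (by fun_prop) (by fun_prop) hh
    (fun x y => le_trans ?_ (H x y)) (hlt f) (hlt g)
  gcongr <;> exact min_le_left _ _

/-- By Tonelli: the inequality on the fibres is exactly the hypothesis needed for the fibre
integrals on the base. -/
lemma PrekopaLeindler.prod {E F : Type*} [AddCommGroup E] [Module ℝ E] [MeasurableSpace E]
    [AddCommGroup F] [Module ℝ F] [MeasurableSpace F] {μ : Measure E} {ν : Measure F}
    [SFinite ν] (hμ : PrekopaLeindler μ) (hν : PrekopaLeindler ν) :
    PrekopaLeindler (μ.prod ν) := by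
  intro a b ha hb hab f g h hf hg hh H
  rw [lintegral_prod _ hf.aemeasurable, lintegral_prod _ hg.aemeasurable,
    lintegral_prod _ hh.aemeasurable]
  refine hμ a b ha hb hab _ _ _ hf.lintegral_prod_right' hg.lintegral_prod_right'
    hh.lintegral_prod_right' fun x y => ?_
  exact hν a b ha hb hab _ _ _ (hf.comp measurable_prodMk_left) (hg.comp measurable_prodMk_left)
    (hh.comp measurable_prodMk_left) fun x' y' => H (x, x') (y, y')

lemma PrekopaLeindler.of_measurePreserving {E F : Type*} [AddCommGroup E] [Module ℝ E]
    [MeasurableSpace E] [AddCommGroup F] [Module ℝ F] [MeasurableSpace F] {μ : Measure E}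
    {ν : Measure F} (hν : PrekopaLeindler ν) (e : F → E) (he : MeasurePreserving e ν μ)
    (hlin : ∀ (a b : ℝ) x y, e (a • x + b • y) = a • e x + b • e y) : PrekopaLeindler μ := by
  intro a b ha hb hab f g h hf hg hh H
  rw [← he.lintegral_comp hf, ← he.lintegral_comp hg, ← he.lintegral_comp hh]
  refine hν a b ha hb hab _ _ _ (hf.comp he.measurable) (hg.comp he.measurable)
    (hh.comp he.measurable) fun x y => ?_
  rw [hlin]
  exact H _ _

lemma prekopaLeindler_pi (n : ℕ) : PrekopaLeindler (volume : Measure (Fin n → ℝ)) := by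
  induction n with
  | zero =>
    intro a b ha hb hab f g h hf hg hh H
    simp only [volume_pi, Measure.pi_of_empty (fun _ : Fin 0 => (volume : Measure ℝ)) 0,
      lintegral_dirac' _ hf, lintegral_dirac' _ hg, lintegral_dirac' _ hh]
    simpa using H 0 0
  | succ n ih =>
    have := (volume_preserving_piFinSuccAbove (fun _ : Fin (n + 1) => ℝ) 0).symm
    refine (Real.prekopaLeindler.prod ih).of_measurePreserving _ this fun a b x y => ?_
    ext i
    refine Fin.cases ?_ (fun i => ?_) i <;>
      simp [MeasurableEquiv.piFinSuccAbove]

/-- The Prékopa-Leindler inequality. -/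
theorem EuclideanSpace.prekopaLeindler (n : ℕ) :
    PrekopaLeindler (volume : Measure (EuclideanSpace ℝ (Fin n))) :=
  (prekopaLeindler_pi n).of_measurePreserving _ (PiLp.volume_preserving_toLp (Fin n))
    fun a b x y => by simp

/-! ### Pushing the complement of a convex set outward. -/

/-- An expanding map does not decrease Lebesgue measure. -/
lemma EuclideanSpace.volume_inter_preimage_le_of_expanding {n : ℕ}
    {U : Set (EuclideanSpace ℝ (Fin n))}
    {S : EuclideanSpace ℝ (Fin n) → EuclideanSpace ℝ (Fin n)}
    (hS : ∀ x ∈ U, ∀ y ∈ U, dist x y ≤ dist (S x) (S y)) (B : Set (EuclideanSpace ℝ (Fin n))) :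
    volume (U ∩ S ⁻¹' B) ≤ volume B := by
  have hanti : AntilipschitzWith 1 (fun x : U => S x) :=
    AntilipschitzWith.of_le_mul_dist fun x y => by
      simpa [Subtype.dist_eq] using hS x x.2 y y.2
  have h1 := hanti.hausdorffMeasure_preimage_le (d := n) (by positivity) B
  rw [← (isometry_subtype_coe (s := U)).hausdorffMeasure_image (Or.inl (by positivity))] at h1
  have e : ((↑) : U → EuclideanSpace ℝ (Fin n)) '' ((fun x : U => S x) ⁻¹' B) = U ∩ S ⁻¹' B := by
    ext x; simp; tauto
  rw [e] at h1
  -- Hausdorff measure in dimension `n` is a multiple of Lebesgue measure, so its estimate for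
  -- antilipschitz maps transfers.
  have hH : (Measure.hausdorffMeasure n : Measure (EuclideanSpace ℝ (Fin n))).IsAddHaarMeasure := by
    have := MeasureTheory.isAddHaarMeasure_hausdorffMeasure (E := EuclideanSpace ℝ (Fin n))
    simpa using this
  rw [Measure.isAddLeftInvariant_eq_smul (volume : Measure (EuclideanSpace ℝ (Fin n)))
    (Measure.hausdorffMeasure n)]
  simp only [Measure.smul_apply, ENNReal.smul_def, smul_eq_mul]
  exact mul_le_mul' le_rfl (by simpa using h1)

/-- The nearest point projection onto a closed convex set. -/
lemma exists_convex_projection {E : Type*} [NormedAddCommGroup E] [InnerProductSpace ℝ E]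
    [CompleteSpace E] {A : Set E} (hA : Convex ℝ A) (hc : IsClosed A) (hne : A.Nonempty) :
    ∃ p : E → E, (∀ x, p x ∈ A) ∧ ∀ x, ∀ a ∈ A, inner ℝ (x - p x) (a - p x) ≤ 0 := by
  choose p hp hp' using fun x => exists_norm_eq_iInf_of_complete_convex hne hc.isComplete hA x
  exact ⟨p, hp, fun x => (norm_eq_iInf_iff_real_inner_le_zero hA (hp x)).1 (hp' x)⟩

section Push

variable {E : Type*} [NormedAddCommGroup E] [InnerProductSpace ℝ E] {A : Set E} {p : E → E}

/-- Adding the variational inequalities at `x` and `y` gives `‖p x - p y‖² ≤ ⟪x - y, p x - p y⟫`, so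
`p` is 1-Lipschitz. -/
lemma convex_projection_continuous (hp : ∀ x, p x ∈ A)
    (hp' : ∀ x, ∀ a ∈ A, inner ℝ (x - p x) (a - p x) ≤ 0) : Continuous p := by
  refine (LipschitzWith.of_dist_le_mul (K := 1) fun x y => ?_).continuous
  have h1 := hp' x (p y) (hp y)
  have h2 := hp' y (p x) (hp x)
  have h3 : inner ℝ (x - y) (p x - p y) = inner ℝ (p x - p y) (p x - p y)
      - inner ℝ (x - p x) (p y - p x) - inner ℝ (y - p y) (p x - p y) := by
    simp only [inner_sub_left, inner_sub_right]; ring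
  have h4 := real_inner_le_norm (x - y) (p x - p y)
  have h5 := real_inner_self_eq_norm_sq (p x - p y)
  rw [dist_eq_norm, dist_eq_norm, NNReal.coe_one, one_mul]
  by_contra! h
  nlinarith [norm_nonneg (x - y), norm_nonneg (p x - p y)]

/-- The map pushing points away from the image of the projection `p` by distance `ε`. -/
noncomputable def pushAway (p : E → E) (ε : ℝ) (x : E) : E :=
  x + (ε * ‖x - p x‖⁻¹) • (x - p x)

/-- The outward unit vector at `x` is a subgradient of the distance to `A`, a convex function. -/
lemma inner_unit_sub (hp : ∀ x, p x ∈ A) (hp' : ∀ x, ∀ a ∈ A, inner ℝ (x - p x) (a - p x) ≤ 0)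
    {x y : E} (hx : x ∉ A) :
    ‖x - p x‖ - ‖y - p y‖ ≤ ‖x - p x‖⁻¹ * inner ℝ (x - p x) (x - y) := by
  have hpos : 0 < ‖x - p x‖ := by
    rw [norm_pos_iff, sub_ne_zero]; intro h; exact hx (h ▸ hp x)
  have h1 := hp' x (p y) (hp y)
  have h2 : inner ℝ (x - p x) (x - y) = inner ℝ (x - p x) (x - p x)
      - inner ℝ (x - p x) (p y - p x) - inner ℝ (x - p x) (y - p y) := by
    simp only [inner_sub_left, inner_sub_right]; ring
  have h3 := real_inner_le_norm (x - p x) (y - p y)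
  have h5 := real_inner_self_eq_norm_sq (x - p x)
  rw [inv_mul_eq_div, le_div_iff₀ hpos]
  nlinarith

/-- Subgradients are monotone: summing the two subgradient inequalities shows that the displacements
do not bring points together, and Cauchy-Schwarz turns this into a distance bound. -/
lemma dist_le_dist_pushAway (hp : ∀ x, p x ∈ A)
    (hp' : ∀ x, ∀ a ∈ A, inner ℝ (x - p x) (a - p x) ≤ 0) {ε : ℝ} (hε : 0 ≤ ε)
    {x y : E} (hx : x ∉ A) (hy : y ∉ A) : dist x y ≤ dist (pushAway p ε x) (pushAway p ε y) := by
  have h1 := inner_unit_sub hp hp' (y := y) hx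
  have h2 := inner_unit_sub hp hp' (y := x) hy
  have h3 : inner ℝ (pushAway p ε x - pushAway p ε y) (x - y) = inner ℝ (x - y) (x - y) +
      ε * (‖x - p x‖⁻¹ * inner ℝ (x - p x) (x - y) + ‖y - p y‖⁻¹ * inner ℝ (y - p y) (y - x)) := by
    rw [← neg_sub x y, inner_neg_right]
    simp only [pushAway, inner_sub_left (𝕜 := ℝ), inner_add_left, real_inner_smul_left]
    ring
  have h4 := real_inner_le_norm (pushAway p ε x - pushAway p ε y) (x - y)
  have h5 := real_inner_self_eq_norm_sq (x - y)
  have h6 : 0 ≤ ε * (‖x - p x‖⁻¹ * inner ℝ (x - p x) (x - y) +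
      ‖y - p y‖⁻¹ * inner ℝ (y - p y) (y - x)) := mul_nonneg hε (by linarith)
  rw [dist_eq_norm, dist_eq_norm]
  by_contra! h
  nlinarith [norm_nonneg (x - y), norm_nonneg (pushAway p ε x - pushAway p ε y)]

lemma norm_pushAway_sub_le {ε : ℝ} (hε : 0 ≤ ε) (x : E) : ‖x - pushAway p ε x‖ ≤ ε := by
  rw [pushAway, sub_add_cancel_left, norm_neg, norm_smul, Real.norm_of_nonneg (by positivity),
    mul_assoc]
  exact mul_le_of_le_one_right hε (inv_mul_le_one)

/-- The supporting half-space of `A` at `p x`, widened by `ε`, contains the thickening; the pushed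
point exceeds its threshold by `‖x - p x‖²`. -/
lemma pushAway_notMem (hp : ∀ x, p x ∈ A)
    (hp' : ∀ x, ∀ a ∈ A, inner ℝ (x - p x) (a - p x) ≤ 0) {ε : ℝ} (hε : 0 ≤ ε)
    {x : E} (hx : x ∉ A) : pushAway p ε x ∉ A + ε • Metric.closedBall (0 : E) 1 := by
  rintro ⟨a, ha, _, ⟨u, hu, rfl⟩, h⟩
  have hpos : 0 < ‖x - p x‖ := by
    rw [norm_pos_iff, sub_ne_zero]; intro h; exact hx (h ▸ hp x)
  have h1 := hp' x a ha
  have h2 : ‖u‖ ≤ 1 := by simpa using hu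
  have h3 := real_inner_le_norm (x - p x) u
  have h4 : inner ℝ (x - p x) (pushAway p ε x - p x) = ‖x - p x‖ ^ 2 + ε * ‖x - p x‖ := by
    have : pushAway p ε x - p x = (x - p x) + (ε * ‖x - p x‖⁻¹) • (x - p x) := by
      rw [pushAway]; abel
    rw [this, inner_add_right, real_inner_smul_right, real_inner_self_eq_norm_sq]
    field_simp
  have h5 : inner ℝ (x - p x) (pushAway p ε x - p x)
      = inner ℝ (x - p x) (a - p x) + ε * inner ℝ (x - p x) u := by
    rw [← h, ← real_inner_smul_right, ← inner_add_right]
    congr 1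
    simp only
    abel
  have h6 : ε * inner ℝ (x - p x) u ≤ ε * ‖x - p x‖ := by
    refine mul_le_mul_of_nonneg_left ?_ hε
    nlinarith
  nlinarith

end Push

/-- If `F` dominates `f` on balls of radius `ε`, the `F`-mass outside the `ε`-neighbourhood of a
convex set dominates the `f`-mass outside the set. -/
lemma lintegral_compl_le_lintegral_compl_thickening {n : ℕ}
    {A : Set (EuclideanSpace ℝ (Fin n))} (hA : Convex ℝ A) (hc : IsCompact A) (hne : A.Nonempty)
    {f F : EuclideanSpace ℝ (Fin n) → ℝ≥0∞} (hF : Measurable F) {ε : ℝ} (hε : 0 ≤ ε)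
    (hfF : ∀ x y, ‖x - y‖ ≤ ε → f x ≤ F y) :
    ∫⁻ x in Aᶜ, f x ≤
      ∫⁻ x in (A + ε • Metric.closedBall (0 : EuclideanSpace ℝ (Fin n)) 1)ᶜ, F x := by
  obtain ⟨p, hp, hp'⟩ := exists_convex_projection hA hc.isClosed hne
  have hpm : Measurable p := (convex_projection_continuous hp hp').measurable
  have hSm : Measurable (pushAway p ε) := by
    unfold pushAway; fun_prop
  set V := A + ε • Metric.closedBall (0 : EuclideanSpace ℝ (Fin n)) 1 with hV
  have hVm : MeasurableSet V :=
    (hc.add ((isCompact_closedBall 0 1).smul ε)).measurableSet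
  -- Expansion bounds the pushforward by Lebesgue measure, and the image of `Aᶜ` avoids `V`.
  have hle : (volume.restrict Aᶜ).map (pushAway p ε) ≤ volume.restrict Vᶜ := by
    refine Measure.le_iff.2 fun B hB => ?_
    rw [Measure.map_apply hSm hB, Measure.restrict_apply (hSm hB), Measure.restrict_apply hB]
    refine le_trans (measure_mono ?_) (EuclideanSpace.volume_inter_preimage_le_of_expanding
      (U := Aᶜ) (fun x hx y hy => dist_le_dist_pushAway hp hp' hε hx hy) (B ∩ Vᶜ))
    rintro x ⟨hxB, hxA⟩
    exact ⟨hxA, hxB, pushAway_notMem hp hp' hε hxA⟩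
  calc ∫⁻ x in Aᶜ, f x ≤ ∫⁻ x in Aᶜ, F (pushAway p ε x) :=
        lintegral_mono fun x => hfF _ _ (norm_pushAway_sub_le hε x)
    _ = ∫⁻ y, F y ∂((volume.restrict Aᶜ).map (pushAway p ε)) := (lintegral_map hF hSm).symm
    _ ≤ _ := lintegral_mono' hle le_rfl

/-! ### Regular representatives of log-concave densities. -/

/-- Borel log-concave functions whose positivity set is open. -/
structure IsRegularLogConcave {E : Type*} [AddCommGroup E] [Module ℝ E] [TopologicalSpace E]
    [MeasurableSpace E] (f : E → ℝ) : Prop where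
  measurable : Measurable f
  nonneg : ∀ x, 0 ≤ f x
  rpow_mul_rpow_le : ∀ x y, ∀ τ ∈ Icc (0 : ℝ) 1,
    f x ^ τ * f y ^ (1 - τ) ≤ f (τ • x + (1 - τ) • y)
  isOpen_pos : IsOpen {x | 0 < f x}

lemma concaveOn_log_of_rpow_mul_rpow_le {E : Type*} [AddCommGroup E] [Module ℝ E] {f : E → ℝ}
    (h : ∀ x y, ∀ τ ∈ Icc (0 : ℝ) 1, f x ^ τ * f y ^ (1 - τ) ≤ f (τ • x + (1 - τ) • y)) :
    ConcaveOn ℝ {x | 0 < f x} fun x => Real.log (f x) := by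
  have key : ∀ x, 0 < f x → ∀ y, 0 < f y → ∀ a b : ℝ, 0 ≤ a → 0 ≤ b → a + b = 1 →
      0 < f x ^ a * f y ^ b ∧ f x ^ a * f y ^ b ≤ f (a • x + b • y) := by
    intro x hx y hy a b ha hb hab
    obtain rfl : b = 1 - a := by linarith
    exact ⟨by positivity, h x y a ⟨ha, by linarith⟩⟩
  refine ⟨fun x hx y hy a b ha hb hab => ?_, fun x hx y hy a b ha hb hab => ?_⟩
  · obtain ⟨h1, h2⟩ := key x hx y hy a b ha hb hab
    exact h1.trans_le h2
  · obtain ⟨h1, h2⟩ := key x hx y hy a b ha hb hab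
    have h3 := Real.log_le_log h1 h2
    rw [mem_ofPred_eq] at hx hy
    rw [Real.log_mul (by positivity) (by positivity), Real.log_rpow hx, Real.log_rpow hy] at h3
    exact h3

lemma IsRegularLogConcave.concaveOn_log {E : Type*} [AddCommGroup E] [Module ℝ E]
    [TopologicalSpace E] [MeasurableSpace E] {f : E → ℝ} (hf : IsRegularLogConcave f) :
    ConcaveOn ℝ {x | 0 < f x} fun x => Real.log (f x) :=
  concaveOn_log_of_rpow_mul_rpow_le hf.rpow_mul_rpow_le

/-- A log-concave function agrees almost everywhere with a regular one. -/
lemma exists_isRegularLogConcave_ae_eq {E : Type*} [NormedAddCommGroup E] [NormedSpace ℝ E]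
    [FiniteDimensional ℝ E] [MeasurableSpace E] [BorelSpace E] (μ : Measure E)
    [μ.IsAddHaarMeasure] {f : E → ℝ} (hf : ∀ x, 0 ≤ f x)
    (h : ∀ x y, ∀ τ ∈ Icc (0 : ℝ) 1, f x ^ τ * f y ^ (1 - τ) ≤ f (τ • x + (1 - τ) • y)) :
    ∃ g, IsRegularLogConcave g ∧ f =ᵐ[μ] g := by
  have hconc := concaveOn_log_of_rpow_mul_rpow_le h
  set U := interior {x | 0 < f x} with hU
  have hUconv : Convex ℝ U := hconc.1.interior
  have hpos : ∀ x, 0 < U.indicator f x ↔ x ∈ U := fun x => by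
    by_cases hx : x ∈ U
    · simpa [hx] using interior_subset hx
    · simp [hx]
  -- Cutting `f` down to the interior of its convex positivity set changes it only on the frontier,
  -- which is null; on the interior `log f` is concave, hence continuous.
  refine ⟨U.indicator f, ⟨?_, fun x => ?_, fun x y τ hτ => ?_, ?_⟩, ?_⟩
  · have hc : ContinuousOn f U := by
      refine (Real.continuous_exp.comp_continuousOn hconc.continuousOn_interior).congr ?_
      intro x hx
      exact (Real.exp_log (interior_subset hx : x ∈ {x | 0 < f x})).symm
    classical
    rw [← Set.piecewise_eq_indicator]
    exact hc.measurable_piecewise continuousOn_const isOpen_interior.measurableSet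
  · exact Set.indicator_nonneg (fun x _ => hf x) x
  · rcases eq_or_lt_of_le hτ.1 with rfl | h0
    · simp
    rcases eq_or_lt_of_le hτ.2 with rfl | h1
    · simp
    by_cases hx : x ∈ U
    · by_cases hy : y ∈ U
      · have := hUconv hx hy h0.le (sub_nonneg.2 h1.le) (by ring)
        simpa [hx, hy, this] using h x y τ hτ
      · simp only [indicator_of_notMem hy, Real.zero_rpow (sub_pos.2 h1).ne', mul_zero]
        exact Set.indicator_nonneg (fun x _ => hf x) _
    · simp only [indicator_of_notMem hx, Real.zero_rpow h0.ne', zero_mul]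
      exact Set.indicator_nonneg (fun x _ => hf x) _
  · have : {x | 0 < U.indicator f x} = U := Set.ext hpos
    rw [this]
    exact isOpen_interior
  · have h0 := hconc.1.addHaar_frontier μ
    filter_upwards [measure_eq_zero_iff_ae_notMem.1 h0] with x hx
    by_cases hxU : x ∈ U
    · simp [hxU]
    · rw [indicator_of_notMem hxU]
      by_contra hne
      exact hx ⟨subset_closure (lt_of_le_of_ne (hf x) (Ne.symm hne)), hxU⟩

/-! ### Tails and medians of linear functionals. -/

/-- The measure of half-spaces is log-concave. -/
lemma PrekopaLeindler.halfspace_mul_le {E : Type*} [AddCommGroup E] [Module ℝ E]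
    [TopologicalSpace E] [MeasurableSpace E] {ν : Measure E}
    (hν : PrekopaLeindler ν) {f : E → ℝ} (hf : IsRegularLogConcave f)
    {ℓ : E →ₗ[ℝ] ℝ} (hℓ : Measurable ℓ) (b : ℝ) {s s' : ℝ} (hs : 0 < s) (hs' : 0 < s') :
    (ν.withDensity fun x => ENNReal.ofReal (f x)) {x | b < ℓ x} *
      (ν.withDensity fun x => ENNReal.ofReal (f x)) {x | b + (s + s') < ℓ x} ≤
    (ν.withDensity fun x => ENNReal.ofReal (f x)) {x | b + s < ℓ x} *
      (ν.withDensity fun x => ENNReal.ofReal (f x)) {x | b + s' < ℓ x} := by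
  have hm : ∀ c, MeasurableSet {x | c < ℓ x} := fun c => measurableSet_lt measurable_const hℓ
  have hfm := hf.measurable
  have key : ∀ p q : ℝ, 0 < p → 0 < q → p + q = 1 → ∀ c d : ℝ,
      ((ν.withDensity fun x => ENNReal.ofReal (f x)) {x | c < ℓ x}) ^ p *
      ((ν.withDensity fun x => ENNReal.ofReal (f x)) {x | d < ℓ x}) ^ q ≤
      (ν.withDensity fun x => ENNReal.ofReal (f x)) {x | p * c + q * d < ℓ x} := by
    intro p q hp hq hpq c d
    simp only [withDensity_apply _ (hm _), ← lintegral_indicator (hm _)]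
    refine hν p q hp hq hpq _ _ _ (by measurability) (by measurability) (by measurability) ?_
    intro x y
    by_cases hx : c < ℓ x
    · by_cases hy : d < ℓ y
      · have hxy : p * c + q * d < ℓ (p • x + q • y) := by
          simp only [map_add, map_smul, smul_eq_mul]
          nlinarith
        simp only [indicator, mem_ofPred_eq, hx, hy, hxy, if_true]
        rw [ENNReal.ofReal_rpow_of_nonneg (hf.nonneg x) hp.le,
          ENNReal.ofReal_rpow_of_nonneg (hf.nonneg y) hq.le,
          ← ENNReal.ofReal_mul (Real.rpow_nonneg (hf.nonneg x) _)]
        refine ENNReal.ofReal_le_ofReal ?_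
        obtain rfl : q = 1 - p := by linarith
        exact hf.rpow_mul_rpow_le x y p ⟨hp.le, by linarith⟩
      · simp [indicator, hy, hq]
    · simp [indicator, hx, hp]
  set G := fun c => (ν.withDensity fun x => ENNReal.ofReal (f x)) {x | c < ℓ x}
  have hsum : 0 < s + s' := by positivity
  have hpq : s' / (s + s') + s / (s + s') = 1 := by field_simp; ring
  -- The points `b + s` and `b + s'` are convex combinations of `b` and `b + (s + s')` with swapped
  -- weights, so the exponents add up to one in the product.
  have k1 := key (s' / (s + s')) (s / (s + s')) (by positivity) (by positivity) hpq b (b + (s + s'))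
  have k2 := key (s / (s + s')) (s' / (s + s')) (by positivity) (by positivity)
    (by rw [add_comm]; exact hpq) b (b + (s + s'))
  have e1 : s' / (s + s') * b + s / (s + s') * (b + (s + s')) = b + s := by field_simp; ring
  have e2 : s / (s + s') * b + s' / (s + s') * (b + (s + s')) = b + s' := by field_simp; ring
  rw [e1] at k1
  rw [e2] at k2
  refine le_trans (le_of_eq ?_) (mul_le_mul' k1 k2)
  change G b * G (b + (s + s')) = G b ^ (s' / (s + s')) * G (b + (s + s')) ^ (s / (s + s')) *
    (G b ^ (s / (s + s')) * G (b + (s + s')) ^ (s' / (s + s')))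
  rw [mul_mul_mul_comm, ← ENNReal.rpow_add_of_nonneg _ _ (by positivity) (by positivity), hpq,
    ← ENNReal.rpow_add_of_nonneg _ _ (by positivity) (by positivity),
    add_comm (s / (s + s')), hpq, ENNReal.rpow_one, ENNReal.rpow_one]

/-- Integrate the hypothesis over the quadrant `s, s' > 0`: the factor `u` is the length of the
range of `s` once `s + s' = u` is fixed. -/
lemma mul_lintegral_mul_le_sq_lintegral {g : ℝ → ℝ≥0∞} (hg : Measurable g) {c : ℝ≥0∞}
    (h : ∀ s s', 0 < s → 0 < s' → c * g (s + s') ≤ g s * g s') :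
    c * ∫⁻ u in Ioi 0, ENNReal.ofReal u * g u ≤ (∫⁻ u in Ioi 0, g u) ^ 2 := by
  have e : ∀ u ∈ Ioi (0 : ℝ), ENNReal.ofReal u * g u = ∫⁻ s in Ioi 0, (Ioi s).indicator g u := by
    intro u hu
    have : ∀ s, (Ioi s).indicator g u = (Iio u).indicator (fun _ => g u) s := fun s => by
      simp [indicator]
    simp only [this]
    rw [lintegral_indicator measurableSet_Iio, lintegral_const, Measure.restrict_restrict
      measurableSet_Iio, Measure.restrict_apply_univ, Iio_inter_Ioi, Real.volume_Ioo, mul_comm,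
      sub_zero]
  have e2 : ∀ s ∈ Ioi (0 : ℝ), ∫⁻ u in Ioi 0, (Ioi s).indicator g u =
      ∫⁻ s' in Ioi 0, g (s + s') := by
    intro s hs
    rw [lintegral_indicator measurableSet_Ioi, Measure.restrict_restrict measurableSet_Ioi,
      inter_eq_left.2 (Ioi_subset_Ioi (le_of_lt hs)), ← lintegral_indicator measurableSet_Ioi,
      ← lintegral_indicator measurableSet_Ioi,
      ← lintegral_add_left_eq_self ((Ioi s).indicator g) s]
    simp [indicator]
  rw [setLIntegral_congr_fun measurableSet_Ioi e, lintegral_lintegral_swap,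
    setLIntegral_congr_fun measurableSet_Ioi e2, sq, ← lintegral_mul_const _ hg,
    ← lintegral_const_mul]
  · refine setLIntegral_mono' measurableSet_Ioi fun s hs => ?_
    rw [← lintegral_const_mul _ hg, ← lintegral_const_mul _ (by fun_prop)]
    exact setLIntegral_mono' measurableSet_Ioi fun s' hs' => h s s' hs hs'
  · exact Measurable.lintegral_prod_right' (f := fun p : ℝ × ℝ => g (p.1 + p.2)) (by fun_prop)
  · refine Measurable.aemeasurable ?_
    have : Function.uncurry (fun u s => (Ioi s).indicator g u) =
        {p : ℝ × ℝ | p.2 < p.1}.indicator (fun p => g p.1) := by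
      ext p; simp [indicator, Function.uncurry]
    rw [this]
    exact (hg.comp measurable_fst).indicator (measurableSet_lt measurable_snd measurable_fst)

/-- A reverse Hölder inequality for the positive part of a linear functional. -/
lemma PrekopaLeindler.lintegral_posPart_sq_le {E : Type*} [AddCommGroup E] [Module ℝ E]
    [TopologicalSpace E] [MeasurableSpace E] {ν : Measure E}
    (hν : PrekopaLeindler ν) {f : E → ℝ} (hf : IsRegularLogConcave f)
    {ℓ : E →ₗ[ℝ] ℝ} (hℓ : Measurable ℓ) (b : ℝ) {μ : Measure E}
    (hμ : μ = ν.withDensity fun x => ENNReal.ofReal (f x)) :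
    μ {x | b < ℓ x} * ∫⁻ x, ENNReal.ofReal ((max (ℓ x - b) 0) ^ 2) ∂μ ≤
      2 * (∫⁻ x, ENNReal.ofReal (max (ℓ x - b) 0) ∂μ) ^ 2 := by
  have hmeas : Measurable fun x => max (ℓ x - b) 0 := by fun_prop
  have hset : ∀ t ∈ Ioi (0 : ℝ), {x | t < max (ℓ x - b) 0} = {x | b + t < ℓ x} := by
    intro t ht
    ext x
    simp only [mem_ofPred_eq, lt_max_iff]
    constructor
    · rintro (h | h)
      · linarith
      · exact absurd h (not_lt.2 (le_of_lt ht))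
    · intro h; left; linarith
  have h1 : ∫⁻ x, ENNReal.ofReal (max (ℓ x - b) 0) ∂μ = ∫⁻ t in Ioi 0, μ {x | b + t < ℓ x} := by
    rw [lintegral_eq_lintegral_meas_lt μ (f := fun x => max (ℓ x - b) 0)
      (.of_forall fun x => le_max_right _ _) hmeas.aemeasurable]
    exact setLIntegral_congr_fun measurableSet_Ioi fun t ht => by simp only [hset t ht]
  have hanti : Measurable fun t => μ {x | b + t < ℓ x} :=
    Antitone.measurable fun s t hst => measure_mono fun x (hx : b + t < ℓ x) =>
      show b + s < ℓ x by linarith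
  have h2 : ∫⁻ x, ENNReal.ofReal ((max (ℓ x - b) 0) ^ 2) ∂μ =
      2 * ∫⁻ t in Ioi 0, ENNReal.ofReal t * μ {x | b + t < ℓ x} := by
    have := lintegral_comp_eq_lintegral_meas_lt_mul (g := fun t => 2 * t) μ
      (.of_forall fun x => le_max_right (ℓ x - b) 0) hmeas.aemeasurable
      (fun t _ => (by fun_prop : Continuous fun t : ℝ => 2 * t).intervalIntegrable _ _)
      (by filter_upwards [ae_restrict_mem measurableSet_Ioi] with t ht
          have : (0 : ℝ) < t := ht
          positivity)
    have e : ∀ y : ℝ, ∫ t in (0 : ℝ)..y, 2 * t = y ^ 2 := fun y => by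
      rw [intervalIntegral.integral_const_mul, integral_id]; ring
    simp only [e] at this
    rw [this, ← lintegral_const_mul' _ _ ENNReal.ofNat_ne_top]
    refine setLIntegral_congr_fun measurableSet_Ioi fun t ht => ?_
    simp only [hset t ht]
    rw [ENNReal.ofReal_mul zero_le_two, ENNReal.ofReal_ofNat]
    ring
  rw [h1, h2, mul_left_comm]
  gcongr
  refine mul_lintegral_mul_le_sq_lintegral hanti fun s s' hs hs' => ?_
  rw [hμ]
  exact hν.halfspace_mul_le hf hℓ b hs hs'

/-- The level sets of a nonzero linear functional are null. -/
lemma LinearMap.addHaar_levelSet_eq_zero {E : Type*} [NormedAddCommGroup E] [NormedSpace ℝ E]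
    [FiniteDimensional ℝ E] [MeasurableSpace E] [BorelSpace E] (ν : Measure E)
    [ν.IsAddHaarMeasure] {ℓ : E →ₗ[ℝ] ℝ} (hℓ : ℓ ≠ 0) (b : ℝ) : ν {x | ℓ x = b} = 0 := by
  obtain ⟨x₀, hx₀⟩ := LinearMap.surjective hℓ b
  have e : {x | ℓ x = b} = (fun x => x + -x₀) ⁻¹' (LinearMap.ker ℓ : Set E) := by
    ext x
    simp [hx₀, sub_eq_zero, ← sub_eq_add_neg]
  rw [e, measure_preimage_add_right]
  exact Measure.addHaar_submodule ν _ fun h => hℓ (LinearMap.ker_eq_top.1 h)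

lemma exists_median_of_nullSingleton (ν : Measure ℝ) [IsProbabilityMeasure ν]
    (h : ∀ a, ν {a} = 0) : ∃ b, ν (Ioi b) = 1 / 2 := by
  have hc : Continuous (cdf ν) := by
    refine continuous_iff_continuousAt.2 fun a => ?_
    rw [(monotone_cdf ν).continuousAt_iff_leftLim_eq_rightLim, StieltjesFunction.rightLim_eq]
    have h1 := (cdf ν).measure_singleton a
    rw [measure_cdf, h, eq_comm, ENNReal.ofReal_eq_zero] at h1
    exact le_antisymm ((monotone_cdf ν).leftLim_le le_rfl) (by linarith)
  obtain ⟨x, hx⟩ := ((tendsto_cdf_atBot ν).eventually_le_const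
    (by norm_num : (0 : ℝ) < 1 / 2)).exists
  obtain ⟨y, hy⟩ := ((tendsto_cdf_atTop ν).eventually_const_le
    (by norm_num : (1 / 2 : ℝ) < 1)).exists
  obtain ⟨b, hb⟩ := mem_range_of_exists_le_of_exists_ge hc ⟨x, hx⟩ ⟨y, hy⟩
  refine ⟨b, ?_⟩
  rw [cdf_eq_real] at hb
  have h1 : ν (Iic b) = 1 / 2 := by
    rw [← ENNReal.ofReal_toReal (measure_ne_top ν (Iic b))]
    change ENNReal.ofReal (ν.real (Iic b)) = _
    rw [hb]
    simp
  rw [← compl_Iic, prob_compl_eq_one_sub measurableSet_Iic, h1]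
  exact ENNReal.sub_eq_of_eq_add (by simp) (by simp [ENNReal.inv_two_add_inv_two])

/-- A centered linear functional on a log-concave probability space has large mean beyond its
median. -/
lemma PrekopaLeindler.exists_halfspace_integral_ge {E : Type*} [NormedAddCommGroup E]
    [NormedSpace ℝ E] [FiniteDimensional ℝ E] [MeasurableSpace E] [BorelSpace E] {ν : Measure E}
    [ν.IsAddHaarMeasure] (hν : PrekopaLeindler ν) {f : E → ℝ} (hf : IsRegularLogConcave f)
    {μ : Measure E} [IsProbabilityMeasure μ]
    (hμ : μ = ν.withDensity fun x => ENNReal.ofReal (f x))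
    {ℓ : E →ₗ[ℝ] ℝ} (hℓ : ℓ ≠ 0) (h2 : MemLp ℓ 2 μ) (h1 : ∫ x, ℓ x ∂μ = 0) :
    ∃ b, μ {x | b < ℓ x} = 1 / 2 ∧
      ∫ x, ℓ x ^ 2 ∂μ ≤ (4 * ∫ x in {x | b < ℓ x}, ℓ x ∂μ) ^ 2 ∧
      0 ≤ ∫ x in {x | b < ℓ x}, ℓ x ∂μ := by
  have hm : Measurable ℓ := ℓ.continuous_of_finiteDimensional.measurable
  have hlev : ∀ b, μ {x | ℓ x = b} = 0 := fun b => by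
    rw [hμ]
    exact withDensity_absolutelyContinuous _ _ (LinearMap.addHaar_levelSet_eq_zero ν hℓ b)
  have : IsProbabilityMeasure (μ.map ℓ) := Measure.isProbabilityMeasure_map hm.aemeasurable
  obtain ⟨b, hb⟩ := exists_median_of_nullSingleton (μ.map ℓ) fun a => by
    rw [Measure.map_apply hm (measurableSet_singleton a)]; exact hlev a
  rw [Measure.map_apply hm measurableSet_Ioi] at hb
  change μ {x | b < ℓ x} = 1 / 2 at hb
  have hbm : MeasurableSet {x | b < ℓ x} := measurableSet_lt measurable_const hm
  -- Level sets are null, so the opposite half-space also has mass one half and the tail estimate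
  -- applies to `-ℓ` too.
  have hb' : μ {x | -b < (-ℓ) x} = 1 / 2 := by
    have e : ({x | b < ℓ x}ᶜ : Set E) =ᵐ[μ] {x | -b < (-ℓ) x} := by
      filter_upwards [measure_eq_zero_iff_ae_notMem.1 (hlev b)] with x hx
      have hx' : ℓ x ≠ b := hx
      simp only [LinearMap.neg_apply, eq_iff_iff]
      change ¬ (b < ℓ x) ↔ -b < -ℓ x
      rw [not_lt, neg_lt_neg_iff]
      exact ⟨fun h => lt_of_le_of_ne h hx', le_of_lt⟩
    rw [← measure_congr e, prob_compl_eq_one_sub hbm, hb]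
    exact ENNReal.sub_eq_of_eq_add (by simp) (by simp [ENNReal.inv_two_add_inv_two])
  have hint : Integrable ℓ μ := h2.integrable one_le_two
  have hsub : MemLp (fun x => ℓ x - b) 2 μ := h2.sub (memLp_const b)
  set P : E → ℝ := fun x => max (ℓ x - b) 0 with hP
  set N : E → ℝ := fun x => max (-(ℓ x - b)) 0 with hN
  have hP2 : MemLp P 2 μ := hsub.pos_part
  have hN2 : MemLp N 2 μ := hsub.neg_part
  have hPi := hP2.integrable one_le_two
  have hNi := hN2.integrable one_le_two
  have hPs := hP2.integrable_sq
  have hNs := hN2.integrable_sq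
  have hP0 : ∀ x, 0 ≤ P x := fun x => le_max_right _ _
  have hN0 : ∀ x, 0 ≤ N x := fun x => le_max_right _ _
  have conv : ∀ Q : E → ℝ, (∀ x, 0 ≤ Q x) → Integrable Q μ → Integrable (fun x => Q x ^ 2) μ →
      1 / 2 * ∫⁻ x, ENNReal.ofReal (Q x ^ 2) ∂μ ≤ 2 * (∫⁻ x, ENNReal.ofReal (Q x) ∂μ) ^ 2 →
      ∫ x, Q x ^ 2 ∂μ ≤ 4 * (∫ x, Q x ∂μ) ^ 2 := by
    intro Q hQ hQi hQs h
    rw [← ofReal_integral_eq_lintegral_ofReal hQi (.of_forall hQ),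
      ← ofReal_integral_eq_lintegral_ofReal hQs (.of_forall fun x => sq_nonneg _),
      ← ENNReal.ofReal_pow (integral_nonneg hQ)] at h
    have h' := ENNReal.toReal_mono (ENNReal.mul_ne_top (by simp) ENNReal.ofReal_ne_top) h
    simp only [ENNReal.toReal_mul, ENNReal.toReal_div, ENNReal.toReal_one, ENNReal.toReal_ofNat,
      ENNReal.toReal_ofReal (integral_nonneg fun x => sq_nonneg (Q x)),
      ENNReal.toReal_ofReal (sq_nonneg (∫ x, Q x ∂μ))] at h'
    linarith
  have kP := conv P hP0 hPi hPs (by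
    have := hν.lintegral_posPart_sq_le hf hm b hμ
    rwa [hb] at this)
  have kN := conv N hN0 hNi hNs (by
    have := hν.lintegral_posPart_sq_le hf (ℓ := -ℓ) hm.neg (-b) hμ
    rw [hb'] at this
    convert this using 6 <;> simp only [hN, LinearMap.neg_apply] <;> ring_nf)
  have e1 : ∫ x, P x ∂μ - ∫ x, N x ∂μ = -b := by
    rw [← integral_sub hPi hNi]
    have : ∀ x, P x - N x = ℓ x - b := fun x => by
      simp only [hP, hN]
      rcases le_total 0 (ℓ x - b) with h | h
      · rw [max_eq_left h, max_eq_right (by linarith)]; ring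
      · rw [max_eq_right h, max_eq_left (by linarith)]; ring
    simp only [this]
    rw [integral_sub hint (integrable_const b), h1]
    simp
  have e2 : ∫ x, P x ^ 2 ∂μ + ∫ x, N x ^ 2 ∂μ = ∫ x, ℓ x ^ 2 ∂μ + b ^ 2 := by
    rw [← integral_add hPs hNs]
    have : ∀ x, P x ^ 2 + N x ^ 2 = ℓ x ^ 2 - 2 * b * ℓ x + b ^ 2 := fun x => by
      simp only [hP, hN]
      rcases le_total 0 (ℓ x - b) with h | h
      · rw [max_eq_left h, max_eq_right (by linarith)]; ring
      · rw [max_eq_right h, max_eq_left (by linarith)]; ring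
    simp only [this]
    have hs : Integrable (fun x => ℓ x ^ 2 - 2 * b * ℓ x) μ :=
      h2.integrable_sq.sub (hint.const_mul _)
    rw [integral_add hs (integrable_const _), integral_sub h2.integrable_sq (hint.const_mul _), integral_const_mul, h1]
    simp
  have e3 : ∫ x in {x | b < ℓ x}, ℓ x ∂μ = ∫ x, P x ∂μ + b / 2 := by
    have : ∀ x, P x = {x | b < ℓ x}.indicator (fun x => ℓ x - b) x := fun x => by
      by_cases hx : b < ℓ x
      · simp [hP, hx, hx.le]
      · simp [hP, hx, not_lt.1 hx]
    simp only [this]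
    rw [integral_indicator hbm, integral_sub hint.integrableOn (integrable_const b)]
    have hr : μ.real {x | b < ℓ x} = 1 / 2 := by simp [Measure.real, hb]
    simp [hr]
    ring
  have i1 : 0 ≤ ∫ x, P x ∂μ := integral_nonneg hP0
  have i2 : 0 ≤ ∫ x, N x ∂μ := integral_nonneg hN0
  refine ⟨b, hb, ?_, ?_⟩ <;> rw [e3]
  -- Centering makes `-b` the difference of the means of `P` and `N`, so the integral of `ℓ` beyond
  -- the median is half their sum. The variance bound follows from `kP`, `kN` and `e2`, dropping the
  -- cross term and `b ^ 2`.
  · have : 4 * (∫ x, P x ∂μ + b / 2) = 2 * (∫ x, P x ∂μ + ∫ x, N x ∂μ) := by linarith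
    rw [this]
    nlinarith [mul_nonneg i1 i2, sq_nonneg b]
  · linarith

/-! ### Boundedness of the density and the mean of its potential. -/

lemma IsRegularLogConcave.continuousOn_log {E : Type*} [NormedAddCommGroup E] [NormedSpace ℝ E]
    [FiniteDimensional ℝ E] [MeasurableSpace E] {f : E → ℝ} (hf : IsRegularLogConcave f) :
    ContinuousOn (fun x => Real.log (f x)) {x | 0 < f x} := by
  have := hf.concaveOn_log.continuousOn_interior
  rwa [hf.isOpen_pos.interior_eq] at this

lemma exists_pos_of_lintegral_eq_one {E : Type*} [MeasurableSpace E] {ν : Measure E} {f : E → ℝ}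
    (h : ∫⁻ x, ENNReal.ofReal (f x) ∂ν = 1) :
    ∃ x, 0 < f x := by
  by_contra! h0
  simp [ENNReal.ofReal_of_nonpos (h0 _)] at h

section Potential

variable {E : Type*} [NormedAddCommGroup E] [NormedSpace ℝ E] [FiniteDimensional ℝ E]
  [MeasurableSpace E] [BorelSpace E] {ν : Measure E} [ν.IsAddHaarMeasure] {f : E → ℝ}

/-- An integrable log-concave function is bounded. -/
lemma IsRegularLogConcave.bddAbove_range (hf : IsRegularLogConcave f)
    (h : ∫⁻ x, ENNReal.ofReal (f x) ∂ν = 1) : BddAbove (range f) := by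
  obtain ⟨x₀, hx₀⟩ := exists_pos_of_lintegral_eq_one h
  have hc : ContinuousAt (fun x => Real.log (f x)) x₀ :=
    hf.continuousOn_log.continuousAt (hf.isOpen_pos.mem_nhds hx₀)
  have hev : ∀ᶠ x in 𝓝 x₀, 0 < f x ∧ Real.log (f x₀) - 1 < Real.log (f x) :=
    (hf.isOpen_pos.eventually_mem hx₀).and (hc.eventually_const_lt (by linarith))
  obtain ⟨r, hr, hball⟩ := Metric.eventually_nhds_iff_ball.1 hev
  set c := Real.exp (Real.log (f x₀) - 1) with hcdef
  have hcpos : 0 < c := Real.exp_pos _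
  have hcf : ∀ x ∈ Metric.ball x₀ r, c ≤ f x := fun x hx => by
    obtain ⟨h1, h2⟩ := hball x hx
    exact ((Real.lt_log_iff_exp_lt h1).1 h2).le
  set v := ν (Metric.ball (0 : E) (r / 2)) with hv
  have hv0 : v ≠ 0 := (Metric.measure_ball_pos ν 0 (by positivity)).ne'
  have hvt : v ≠ ∞ := measure_ball_lt_top.ne
  have hvr : 0 < v.toReal := ENNReal.toReal_pos hv0 hvt
  refine ⟨(1 / v.toReal) ^ 2 / c, ?_⟩
  rintro _ ⟨x, rfl⟩
  -- The midpoints of `x` with the points of `ball x₀ r` fill a ball of radius `r / 2` on which `f ≥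
  -- d`; total mass one then bounds `d`.
  set d := f x ^ (1 / 2 : ℝ) * c ^ (1 - 1 / 2 : ℝ) with hd
  have hd0 : 0 ≤ d := mul_nonneg (Real.rpow_nonneg (hf.nonneg x) _) (Real.rpow_nonneg hcpos.le _)
  have h1 : ENNReal.ofReal d * v ≤ 1 := by
    rw [← h, hv, ← Measure.addHaar_ball_center ν ((1 / 2 : ℝ) • (x + x₀)) (r / 2),
      ← setLIntegral_const]
    refine le_trans (setLIntegral_mono' measurableSet_ball fun y hy => ?_)
      (setLIntegral_le_lintegral _ _)
    refine ENNReal.ofReal_le_ofReal ?_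
    have hz : (2 : ℝ) • y - x ∈ Metric.ball x₀ r := by
      rw [Metric.mem_ball, dist_eq_norm] at hy ⊢
      have : (2 : ℝ) • y - x - x₀ = (2 : ℝ) • (y - (1 / 2 : ℝ) • (x + x₀)) := by
        rw [smul_sub, smul_smul]; norm_num; abel
      rw [this, norm_smul]
      norm_num
      norm_num at hy
      linarith
    have h3 := hf.rpow_mul_rpow_le x ((2 : ℝ) • y - x) (1 / 2) ⟨by norm_num, by norm_num⟩
    have e : (1 / 2 : ℝ) • x + (1 - 1 / 2 : ℝ) • ((2 : ℝ) • y - x) = y := by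
      rw [smul_sub, smul_smul]; norm_num
    rw [e] at h3
    refine le_trans ?_ h3
    rw [hd]
    exact mul_le_mul_of_nonneg_left (Real.rpow_le_rpow hcpos.le (hcf _ hz) (by norm_num))
      (Real.rpow_nonneg (hf.nonneg x) _)
  have h2 : d * v.toReal ≤ 1 := by
    have := ENNReal.toReal_mono ENNReal.one_ne_top h1
    simpa [ENNReal.toReal_mul, ENNReal.toReal_ofReal hd0] using this
  have h3 : d ^ 2 = f x * c := by
    rw [hd, mul_pow, ← Real.rpow_natCast, ← Real.rpow_natCast, ← Real.rpow_mul (hf.nonneg x),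
      ← Real.rpow_mul hcpos.le]
    norm_num
  rw [le_div_iff₀ hcpos, ← h3]
  have h4 : d ≤ 1 / v.toReal := by rwa [le_div_iff₀ hvr]
  gcongr

lemma lintegral_comp_homothety (g : E → ℝ≥0∞) {c : ℝ} (hc : 0 < c) (y : E) :
    ∫⁻ x, g (c • x + y) ∂ν = ENNReal.ofReal ((c ^ Module.finrank ℝ E)⁻¹) * ∫⁻ x, g x ∂ν := by
  have h1 : ∫⁻ x, g (c • x + y) ∂ν = ∫⁻ z, g (z + y) ∂(ν.map (c • ·)) :=
    (lintegral_map_equiv (fun z => g (z + y))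
      (Homeomorph.smulOfNeZero c hc.ne').toMeasurableEquiv).symm
  rw [h1, Measure.map_addHaar_smul ν hc.ne', lintegral_smul_measure, lintegral_add_right_eq_self,
    abs_of_pos (by positivity), smul_eq_mul]

/-- For fixed `y`, log-concavity bounds `f(x)^(1-t) f(y)^t` by `f((1-t)x + ty)`, whose integral in
`x` is a Jacobian factor independent of `y`. The supremum over `y` can then be taken. In terms of
`ψ` this is an exponential moment bound. -/
lemma IsRegularLogConcave.lintegral_rpow_mul_le (hf : IsRegularLogConcave f)
    (h : ∫⁻ x, ENNReal.ofReal (f x) ∂ν = 1) {t : ℝ} (h0 : 0 < t) (h1 : t < 1) :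
    ∫⁻ x, ENNReal.ofReal (f x ^ (1 - t) * (⨆ x, f x) ^ t) ∂ν ≤
      ENNReal.ofReal (((1 - t) ^ Module.finrank ℝ E)⁻¹) := by
  have hb := hf.bddAbove_range h
  have hfm := hf.measurable
  set M := ⨆ x, f x with hM
  have hM0 : 0 ≤ M := (hf.nonneg 0).trans (le_ciSup hb 0)
  have h1' : 0 < 1 - t := by linarith
  have hC0 : 0 < ((1 - t) ^ Module.finrank ℝ E)⁻¹ := by positivity
  set C := ((1 - t) ^ Module.finrank ℝ E)⁻¹ with hC
  set I := ∫⁻ x, ENNReal.ofReal (f x ^ (1 - t)) ∂ν with hI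
  have key : ∀ y, ENNReal.ofReal (f y ^ t) * I ≤ ENNReal.ofReal C := by
    intro y
    have e := lintegral_comp_homothety (ν := ν) (fun x => ENNReal.ofReal (f x)) h1' (t • y)
    rw [h, mul_one] at e
    rw [hI, ← lintegral_const_mul' _ _ ENNReal.ofReal_ne_top, ← e]
    refine lintegral_mono fun x => ?_
    simp only
    rw [← ENNReal.ofReal_mul (Real.rpow_nonneg (hf.nonneg y) _)]
    refine ENNReal.ofReal_le_ofReal ?_
    rw [add_comm]
    exact hf.rpow_mul_rpow_le y x t ⟨h0.le, h1.le⟩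
  have e : ∫⁻ x, ENNReal.ofReal (f x ^ (1 - t) * M ^ t) ∂ν = ENNReal.ofReal (M ^ t) * I := by
    rw [hI, ← lintegral_const_mul' _ _ ENNReal.ofReal_ne_top]
    refine lintegral_congr fun x => ?_
    rw [← ENNReal.ofReal_mul (Real.rpow_nonneg hM0 _), mul_comm]
  rw [e]
  obtain ⟨x₀, hx₀⟩ := exists_pos_of_lintegral_eq_one h
  have hIt : I ≠ ∞ := by
    intro hI'
    have := key x₀
    rw [hI', ENNReal.mul_top (by simpa using Real.rpow_pos_of_pos hx₀ t)] at this
    simp at this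
  rcases eq_or_ne I 0 with hI0 | hI0
  · simp [hI0]
  have hIr := ENNReal.toReal_pos hI0 hIt
  have key' : ∀ y, f y ≤ (C / I.toReal) ^ t⁻¹ := by
    intro y
    have h2 : f y ^ t * I.toReal ≤ C := by
      have := ENNReal.toReal_mono ENNReal.ofReal_ne_top (key y)
      rwa [ENNReal.toReal_mul, ENNReal.toReal_ofReal (Real.rpow_nonneg (hf.nonneg y) _),
        ENNReal.toReal_ofReal hC0.le] at this
    rw [Real.le_rpow_inv_iff_of_pos (hf.nonneg y) (by positivity) h0]
    rwa [le_div_iff₀ hIr]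
  have hMle : M ≤ (C / I.toReal) ^ t⁻¹ := ciSup_le key'
  rw [Real.le_rpow_inv_iff_of_pos hM0 (by positivity) h0, le_div_iff₀ hIr] at hMle
  rw [← ENNReal.ofReal_toReal hIt, ← ENNReal.ofReal_mul (Real.rpow_nonneg hM0 _)]
  exact ENNReal.ofReal_le_ofReal hMle

/-- The potential of a log-concave probability measure, normalized to have minimum zero, has
expectation at most the dimension. -/
lemma IsRegularLogConcave.exists_bound_potential (hf : IsRegularLogConcave f) {μ : Measure E}
    [IsProbabilityMeasure μ] (hμ : μ = ν.withDensity fun x => ENNReal.ofReal (f x)) :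
    ∃ M, 0 < M ∧ (∀ x, f x ≤ M) ∧
      Integrable (fun x => Real.log M - Real.log (f x)) μ ∧
      Integrable (fun x => (Real.log M - Real.log (f x)) ^ 2) μ ∧
      ∫ x, (Real.log M - Real.log (f x)) ∂μ ≤ Module.finrank ℝ E := by
  have hfm := hf.measurable
  have h : ∫⁻ x, ENNReal.ofReal (f x) ∂ν = 1 := by
    have := measure_univ (μ := μ)
    rwa [hμ, withDensity_apply _ MeasurableSet.univ, Measure.restrict_univ] at this
  have hb := hf.bddAbove_range h
  set M := ⨆ x, f x with hM
  have hfM : ∀ x, f x ≤ M := fun x => le_ciSup hb x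
  obtain ⟨x₀, hx₀⟩ := exists_pos_of_lintegral_eq_one h
  have hM0 : 0 < M := hx₀.trans_le (hfM x₀)
  set ψ : E → ℝ := fun x => Real.log M - Real.log (f x) with hψ
  have hψm : Measurable ψ := by fun_prop
  have hpos : ∀ᵐ x ∂μ, 0 < f x := by
    rw [hμ, ae_withDensity_iff (by fun_prop)]
    exact .of_forall fun x hx => by simpa using hx
  have hψ0 : ∀ᵐ x ∂μ, 0 ≤ ψ x := by
    filter_upwards [hpos] with x hx
    exact sub_nonneg.2 (Real.log_le_log hx (hfM x))
  have hexp : ∀ t, 0 < t → t < 1 → ∫⁻ x, ENNReal.ofReal (Real.exp (t * ψ x)) ∂μ ≤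
      ENNReal.ofReal (((1 - t) ^ Module.finrank ℝ E)⁻¹) := by
    intro t h0 h1
    refine le_trans ?_ (hf.lintegral_rpow_mul_le h h0 h1)
    rw [hμ, lintegral_withDensity_eq_lintegral_mul _ (by fun_prop) (by fun_prop)]
    refine lintegral_mono fun x => ?_
    simp only [Pi.mul_apply]
    rw [← ENNReal.ofReal_mul (hf.nonneg x)]
    refine ENNReal.ofReal_le_ofReal (le_of_eq ?_)
    rcases (hf.nonneg x).eq_or_lt with hx | hx
    · rw [← hx, Real.zero_rpow (by linarith)]; simp
    · rw [Real.rpow_def_of_pos hx, Real.rpow_def_of_pos hM0, ← Real.exp_add]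
      nth_rewrite 1 [← Real.exp_log hx]
      rw [← Real.exp_add]
      congr 1
      simp only [hψ]
      ring
  have hexpi : ∀ t, 0 < t → t < 1 → Integrable (fun x => Real.exp (t * ψ x)) μ := by
    intro t h0 h1
    refine ⟨by fun_prop, ?_⟩
    rw [hasFiniteIntegral_iff_ofReal (.of_forall fun x => (Real.exp_pos _).le)]
    exact (hexp t h0 h1).trans_lt ENNReal.ofReal_lt_top
  have hhalf := hexpi (1 / 2) (by norm_num) (by norm_num)
  have hψi : Integrable ψ μ := by
    refine (hhalf.const_mul 2).mono' hψm.aestronglyMeasurable ?_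
    filter_upwards [hψ0] with x hx
    rw [Real.norm_of_nonneg hx]
    linarith [Real.add_one_le_exp (1 / 2 * ψ x)]
  have hψs : Integrable (fun x => ψ x ^ 2) μ := by
    refine (hhalf.const_mul 8).mono' (by fun_prop) ?_
    filter_upwards [hψ0] with x hx
    rw [Real.norm_of_nonneg (sq_nonneg _)]
    nlinarith [Real.quadratic_le_exp_of_nonneg (x := 1 / 2 * ψ x) (by positivity)]
  refine ⟨M, hM0, hfM, hψi, hψs, ?_⟩
  set κ := ∫ x, ψ x ∂μ with hκ
  have hκ0 : 0 ≤ κ := integral_nonneg_of_ae hψ0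
  set n := Module.finrank ℝ E
  -- Combine `1 + tκ ≤ E exp(tψ) ≤ (1 - t)^(-n)` with Bernoulli's inequality; the error term
  -- disappears as `t → 0`.
  have main : ∀ t, 0 < t → t < 1 → κ ≤ n + t * (n * κ) := by
    intro t h0 h1
    have h1' : 0 < 1 - t := by linarith
    have k1 : 1 + t * κ ≤ ((1 - t) ^ n)⁻¹ := by
      have e1 : ∫ x, (1 + t * ψ x) ∂μ = 1 + t * κ := by
        rw [integral_add (integrable_const _) (hψi.const_mul t), integral_const_mul]
        simp [hκ]
      rw [← e1]
      refine (integral_mono ((integrable_const _).add (hψi.const_mul t)) (hexpi t h0 h1)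
        fun x => ?_).trans ?_
      · simpa [add_comm] using Real.add_one_le_exp (t * ψ x)
      · rw [integral_eq_lintegral_of_nonneg_ae (.of_forall fun x => (Real.exp_pos _).le)
          (by fun_prop)]
        exact ENNReal.toReal_le_of_le_ofReal (by positivity) (hexp t h0 h1)
    have k2 : 1 - n * t ≤ (1 - t) ^ n := by
      have := one_add_mul_le_pow (a := -t) (by linarith) n
      linarith [show (1 : ℝ) + -t = 1 - t by ring, this, show (1 + -t) ^ n = (1 - t) ^ n by ring_nf]
    have k3 : (1 + t * κ) * (1 - t) ^ n ≤ 1 := by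
      rwa [← le_div_iff₀ (by positivity), one_div]
    have k4 : (1 + t * κ) * (1 - n * t) ≤ 1 :=
      (mul_le_mul_of_nonneg_left k2 (by positivity)).trans k3
    nlinarith
  refine le_of_forall_pos_le_add fun e he => ?_
  have hp : 0 < (n : ℝ) * κ + 1 := by positivity
  refine (main (min (1 / 2) (e / (n * κ + 1))) (by positivity)
    ((min_le_left _ _).trans_lt (by norm_num))).trans ?_
  gcongr
  calc min (1 / 2) (e / (n * κ + 1)) * (n * κ) ≤ e / (n * κ + 1) * (n * κ + 1) := by
        gcongr
        · exact min_le_right _ _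
        · linarith
    _ = e := by field_simp

end Potential

/-! ### A lower bound for the density near the origin. -/

/-- Near the barycenter, the density of an isotropic log-concave probability measure is bounded
below in terms of the maximal density and the entropy. -/
lemma IsRegularLogConcave.exp_le_of_norm_lt {E : Type*} [NormedAddCommGroup E]
    [InnerProductSpace ℝ E] [FiniteDimensional ℝ E] [MeasurableSpace E] [BorelSpace E]
    {ν : Measure E} [ν.IsAddHaarMeasure] (hν : PrekopaLeindler ν) {f : E → ℝ}
    (hf : IsRegularLogConcave f) {μ : Measure E} [IsProbabilityMeasure μ]
    (hμ : μ = ν.withDensity fun x => ENNReal.ofReal (f x))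
    (h2 : ∀ θ : E, MemLp (fun x => inner ℝ θ x) 2 μ)
    (hmean : ∀ θ : E, ∫ x, inner ℝ θ x ∂μ = 0)
    (hvar : ∀ θ : E, ∫ x, inner ℝ θ x ^ 2 ∂μ = ‖θ‖ ^ 2)
    {M : ℝ} (hfM : ∀ x, f x ≤ M)
    (hψi : Integrable (fun x => Real.log M - Real.log (f x)) μ) {m : E} (hm : ‖m‖ < 1 / 2) :
    Real.exp (Real.log M - 2 * ∫ x, (Real.log M - Real.log (f x)) ∂μ) ≤ f m := by
  have hfm := hf.measurable
  set ψ : E → ℝ := fun x => Real.log M - Real.log (f x) with hψ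
  set κ := ∫ x, ψ x ∂μ with hκ
  have hpos : ∀ᵐ x ∂μ, 0 < f x := by
    rw [hμ, ae_withDensity_iff (by fun_prop)]
    exact .of_forall fun x hx => by simpa using hx
  have hψ0 : ∀ᵐ x ∂μ, 0 ≤ ψ x := by
    filter_upwards [hpos] with x hx
    exact sub_nonneg.2 (Real.log_le_log hx (hfM x))
  have hκ0 : 0 ≤ κ := integral_nonneg_of_ae hψ0
  obtain ⟨x₀, hx₀⟩ := hpos.exists
  have hcont : Continuous fun η : ℝ => Real.exp (Real.log M - 2 * κ - η) := by fun_prop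
  have hlim : Tendsto (fun η : ℝ => Real.exp (Real.log M - 2 * κ - η)) (𝓝[>] 0)
      (𝓝 (Real.exp (Real.log M - 2 * κ))) := by
    simpa using (hcont.tendsto 0).mono_left nhdsWithin_le_nhds
  refine le_of_tendsto hlim ?_
  -- The slack `η` excludes a horizontal separating hyperplane even when `κ = 0`.
  filter_upwards [self_mem_nhdsWithin] with η (hη : 0 < η)
  by_contra! hlt
  set s₀ := Real.log M - 2 * κ - η with hs₀
  set S : Set (E × ℝ) := {p | p.1 ∈ {x | 0 < f x} ∧ p.2 < Real.log (f p.1)} with hS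
  have hSc : Convex ℝ S := hf.concaveOn_log.convex_strict_hypograph
  have hSo : IsOpen S := by
    have hc1 : ContinuousOn (fun p : E × ℝ => Real.log (f p.1) - p.2)
        (Prod.fst ⁻¹' {x | 0 < f x}) :=
      (hf.continuousOn_log.comp continuousOn_fst fun p hp => hp).sub continuousOn_snd
    have := hc1.isOpen_inter_preimage (hf.isOpen_pos.preimage continuous_fst) isOpen_Ioi (t := Ioi 0)
    convert this using 1
    ext p
    simp [hS]
  have hnot : (m, s₀) ∉ S := by
    rintro ⟨h1, h3⟩
    have := (Real.lt_log_iff_exp_lt h1).1 h3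
    simp only at this
    linarith
  obtain ⟨F, hF⟩ := geometric_hahn_banach_open_point hSc hSo hnot
  set β := F (0, 1) with hβ
  set ℓ : E →L[ℝ] ℝ := F.comp (ContinuousLinearMap.inl ℝ E ℝ) with hℓ
  have hFe : ∀ x s, F (x, s) = ℓ x + s * β := by
    intro x s
    have : (x, s) = (x, (0 : ℝ)) + s • ((0 : E), (1 : ℝ)) := by simp
    rw [this, map_add, map_smul]
    simp [hℓ, hβ]
  have hsep : ∀ x s, 0 < f x → s < Real.log (f x) → ℓ x + s * β < ℓ m + s₀ * β := by
    intro x s hx hs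
    have := hF (x, s) ⟨hx, hs⟩
    rwa [hFe, hFe] at this
  -- The hypograph is unbounded downwards, so a negative `β` would violate the separation.
  have hβ0 : 0 ≤ β := by
    by_contra! hβn
    set s := min (Real.log (f x₀) - 1) ((ℓ m + s₀ * β - ℓ x₀) / β) with hs
    have h3 := hsep x₀ s hx₀ ((min_le_left _ _).trans_lt (by linarith))
    have h4 : s ≤ (ℓ m + s₀ * β - ℓ x₀) / β := min_le_right _ _
    rw [le_div_iff_of_neg hβn] at h4
    linarith
  have hsep' : ∀ x, 0 < f x → ℓ x - ℓ m ≤ β * (ψ x - 2 * κ - η) := by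
    intro x hx
    have hc3 : Continuous fun s : ℝ => ℓ x + s * β := by fun_prop
    have hl : Tendsto (fun s : ℝ => ℓ x + s * β) (𝓝[<] (Real.log (f x)))
        (𝓝 (ℓ x + Real.log (f x) * β)) := (hc3.tendsto _).mono_left nhdsWithin_le_nhds
    have := le_of_tendsto hl (by
      filter_upwards [self_mem_nhdsWithin] with s hs
      exact (hsep x s hx hs).le)
    simp only [hψ]
    simp only [hs₀] at this
    linarith
  have hae : ∀ᵐ x ∂μ, ℓ x - ℓ m ≤ β * (ψ x - 2 * κ - η) := by
    filter_upwards [hpos] with x hx using hsep' x hx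
  set θ := (InnerProductSpace.toDual ℝ E).symm ℓ with hθ
  have hℓθ : ∀ x, ℓ x = inner ℝ θ x := fun x => by simp [hθ]
  have hℓ2 : MemLp ℓ 2 μ := by simpa only [← hℓθ] using h2 θ
  have hℓi : Integrable ℓ μ := hℓ2.integrable one_le_two
  have hℓ1 : ∫ x, ℓ x ∂μ = 0 := by simpa only [← hℓθ] using hmean θ
  have hℓv : ∫ x, ℓ x ^ 2 ∂μ = ‖θ‖ ^ 2 := by simpa only [← hℓθ] using hvar θ
  have hri : Integrable (fun x => β * (ψ x - 2 * κ - η)) μ :=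
    (((hψi.sub (integrable_const _)).sub (integrable_const _)).const_mul β)
  have hli : Integrable (fun x => ℓ x - ℓ m) μ := hℓi.sub (integrable_const _)
  by_cases hθ0 : θ = 0
  · have hℓz : ∀ x, ℓ x = 0 := fun x => by rw [hℓθ, hθ0, inner_zero_left]
    have h3 := integral_mono_ae hli hri hae
    have e : ∫ x, β * (ψ x - 2 * κ - η) ∂μ = β * (κ - 2 * κ - η) := by
      have hs1 : Integrable (fun x => ψ x - 2 * κ) μ := hψi.sub (integrable_const _)
      rw [integral_const_mul, integral_sub hs1 (integrable_const _),
        integral_sub hψi (integrable_const _)]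
      simp [hκ]
    rw [e] at h3
    simp only [hℓz, sub_zero, integral_zero] at h3
    have hβz : β = 0 := by nlinarith
    have := hsep x₀ (Real.log (f x₀) - 1) hx₀ (by linarith)
    simp [hℓz, hβz] at this
  · have hne : (ℓ : E →ₗ[ℝ] ℝ) ≠ 0 := by
      intro h0
      apply hθ0
      have h3 := hℓθ θ
      rw [real_inner_self_eq_norm_sq, show ℓ θ = (ℓ : E →ₗ[ℝ] ℝ) θ from rfl, h0] at h3
      simpa using h3.symm
    obtain ⟨b, hb, hb2, hb0⟩ := hν.exists_halfspace_integral_ge hf hμ hne hℓ2 hℓ1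
    simp only [ContinuousLinearMap.coe_coe] at hb hb2 hb0
    set H := {x | b < ℓ x} with hH
    have hr : μ.real H = 1 / 2 := by simp [Measure.real, hb]
    -- On a set of mass one half the constant `2κ` integrates to `κ`, which absorbs the integral of
    -- `ψ`. What remains is `‖θ‖ / 4 ≤ ℓ m / 2`, against `‖m‖ < 1/2`.
    have h3 := setIntegral_mono_ae (s := H) hli.integrableOn hri.integrableOn hae
    have e1 : ∫ x in H, (ℓ x - ℓ m) ∂μ = ∫ x in H, ℓ x ∂μ - ℓ m / 2 := by
      rw [integral_sub hℓi.integrableOn (integrable_const _)]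
      simp [hr]
      ring
    have e2 : ∫ x in H, β * (ψ x - 2 * κ - η) ∂μ = β * (∫ x in H, ψ x ∂μ - κ - η / 2) := by
      have hs1 : Integrable (fun x => ψ x - 2 * κ) (μ.restrict H) :=
        hψi.integrableOn.sub (integrable_const _)
      rw [integral_const_mul, integral_sub hs1 (integrable_const _),
        integral_sub hψi.integrableOn (integrable_const _)]
      simp [hr]
      left
      ring
    rw [e1, e2] at h3
    have h4 : ∫ x in H, ψ x ∂μ ≤ κ := setIntegral_le_integral hψi hψ0
    have h5 : ‖θ‖ ≤ 4 * ∫ x in H, ℓ x ∂μ := by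
      rw [hℓv] at hb2
      exact abs_le_of_sq_le_sq' hb2 (by positivity) |>.2
    have h6 : ℓ m ≤ ‖θ‖ * ‖m‖ := by rw [hℓθ]; exact real_inner_le_norm _ _
    have h7 : 0 < ‖θ‖ := norm_pos_iff.2 hθ0
    nlinarith

/-! ### Isotropy and the perimeter bound. -/

lemma IsIsotropicMeasure.memLp_inner {n : ℕ} {μ : Measure (EuclideanSpace ℝ (Fin n))}
    (h : IsIsotropicMeasure μ) (θ : EuclideanSpace ℝ (Fin n)) :
    MemLp (fun x => inner ℝ θ x) 2 μ := h.memLp.const_inner θ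

lemma IsIsotropicMeasure.integral_inner_eq_zero {n : ℕ} {μ : Measure (EuclideanSpace ℝ (Fin n))}
    [IsProbabilityMeasure μ] (h : IsIsotropicMeasure μ) (θ : EuclideanSpace ℝ (Fin n)) :
    ∫ x, inner ℝ θ x ∂μ = 0 := by
  rw [integral_inner (h.memLp.integrable one_le_two), h.barycenter_eq_zero, inner_zero_right]

lemma IsIsotropicMeasure.integral_inner_sq {n : ℕ} {μ : Measure (EuclideanSpace ℝ (Fin n))}
    [IsProbabilityMeasure μ] (h : IsIsotropicMeasure μ) (θ : EuclideanSpace ℝ (Fin n)) :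
    ∫ x, inner ℝ θ x ^ 2 ∂μ = ‖θ‖ ^ 2 := by
  have hi : ∀ i, MemLp (fun x : EuclideanSpace ℝ (Fin n) => x i) 2 μ := fun i => by
    have := h.memLp_inner (EuclideanSpace.single i (1 : ℝ))
    simpa [EuclideanSpace.inner_single_left] using this
  have hm := (h.memLp_inner θ).1.aemeasurable
  rw [← variance_of_integral_eq_zero hm (h.integral_inner_eq_zero θ), ← covariance_self hm]
  have e : (fun x => inner ℝ θ x) = fun x : EuclideanSpace ℝ (Fin n) => ∑ i, θ i * x i := by
    ext x
    simp [PiLp.inner_apply, mul_comm]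
  rw [e, covariance_fun_sum_fun_sum (fun i => (hi i).const_mul _) fun i => (hi i).const_mul _]
  have hc : ∀ i j, cov[fun x => x i, fun x => x j; μ] = (1 : Matrix (Fin n) (Fin n) ℝ) i j :=
    fun i j => congr_fun₂ h.covMatrix_eq_one i j
  simp only [covariance_const_mul_left, covariance_const_mul_right, hc, Matrix.one_apply,
    EuclideanSpace.norm_sq_eq]
  simp [sq]

/-- The left side counts `Aᶜ` and the thickening once each. Pushing `Aᶜ` off the thickening makes
the two pieces disjoint, at the price of replacing `f` by `F`. -/
lemma measure_univ_add_measure_shell_le {n : ℕ}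
    {A : Set (EuclideanSpace ℝ (Fin n))} (hA : Convex ℝ A) (hc : IsCompact A) (hne : A.Nonempty)
    {f F : EuclideanSpace ℝ (Fin n) → ℝ≥0∞} (hF : Measurable F) {ε : ℝ} (hε : 0 ≤ ε)
    (hfF : ∀ x y, ‖x - y‖ ≤ ε → f x ≤ F y) {μ : Measure (EuclideanSpace ℝ (Fin n))}
    (hμ : μ = volume.withDensity f) :
    μ univ + μ ((A + ε • Metric.closedBall (0 : EuclideanSpace ℝ (Fin n)) 1) \ A) ≤
      ∫⁻ x, F x := by
  set V := A + ε • Metric.closedBall (0 : EuclideanSpace ℝ (Fin n)) 1 with hV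
  have hVm : MeasurableSet V := (hc.add ((isCompact_closedBall 0 1).smul ε)).measurableSet
  have hAm : MeasurableSet A := hc.measurableSet
  have hAV : A ⊆ V := fun a ha => ⟨a, ha, 0, ⟨0, by simp, by simp⟩, by simp⟩
  calc μ univ + μ (V \ A) = μ Aᶜ + μ V := by
        rw [← measure_add_measure_compl hAm, ← measure_inter_add_sdiff V hAm,
          inter_eq_right.2 hAV]
        ring
    _ = (∫⁻ x in Aᶜ, f x) + ∫⁻ x in V, f x := by
        rw [hμ, withDensity_apply _ hAm.compl, withDensity_apply _ hVm]
    _ ≤ (∫⁻ x in Vᶜ, F x) + ∫⁻ x in V, F x := by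
        refine add_le_add (lintegral_compl_le_lintegral_compl_thickening hA hc hne hF hε hfF)
          (lintegral_mono fun x => hfF x x (by simpa using hε))
    _ = ∫⁻ x, F x := by rw [add_comm, lintegral_add_compl F hVm]

/-- The growth of a log-concave function under translations of length `r * δ` is controlled by
its values on a dilate. -/
lemma IsRegularLogConcave.le_mul_exp_of_norm_sub_le {E : Type*} [NormedAddCommGroup E]
    [NormedSpace ℝ E] [MeasurableSpace E] {f : E → ℝ} (hf : IsRegularLogConcave f)
    {a r δ : ℝ} (hδ : 0 < δ) (hlow : ∀ m : E, ‖m‖ ≤ r → Real.exp a ≤ f m) {x y : E}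
    (hxy : ‖x - y‖ ≤ r * δ) :
    f x ≤ f ((1 + δ)⁻¹ • y) * Real.exp (δ * (Real.log (f ((1 + δ)⁻¹ • y)) - a)) := by
  rcases (hf.nonneg x).eq_or_lt with hx | hx
  · rw [← hx]
    exact mul_nonneg (hf.nonneg _) (Real.exp_pos _).le
  set q := (1 + δ)⁻¹ • y with hq
  -- Chosen so that `q` is the convex combination of `x` and `m` with weights `1/(1+δ)` and
  -- `δ/(1+δ)`.
  set m := δ⁻¹ • (y - x) with hm
  have hmr : ‖m‖ ≤ r := by
    rw [hm, norm_smul, norm_inv, Real.norm_of_nonneg hδ.le, norm_sub_rev, inv_mul_le_iff₀ hδ,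
      mul_comm]
    exact hxy
  have hfm : Real.exp a ≤ f m := hlow m hmr
  have hfm0 : 0 < f m := (Real.exp_pos _).trans_le hfm
  have hloga : a ≤ Real.log (f m) := (Real.le_log_iff_exp_le hfm0).2 hfm
  have h1 : 0 < 1 + δ := by positivity
  have hcomb : (1 + δ)⁻¹ • x + (δ * (1 + δ)⁻¹) • m = q := by
    rw [hm, hq, smul_smul, mul_right_comm, mul_inv_cancel₀ hδ.ne', one_mul, ← smul_add]
    congr 1
    abel
  have hsum : (1 + δ)⁻¹ + δ * (1 + δ)⁻¹ = 1 := by field_simp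
  have hconc := hf.concaveOn_log
  have hq0 : 0 < f q := by
    rw [← hcomb]; exact hconc.1 hx hfm0 (by positivity) (by positivity) hsum
  have h2 := hconc.2 hx hfm0 (by positivity) (by positivity) hsum
  rw [hcomb] at h2
  simp only [smul_eq_mul] at h2
  have h3 : Real.log (f x) ≤ Real.log (f q) + δ * (Real.log (f q) - a) := by
    have h4 := mul_le_mul_of_nonneg_left h2 h1.le
    have e : (1 + δ) * ((1 + δ)⁻¹ * Real.log (f x) + δ * (1 + δ)⁻¹ * Real.log (f m)) =
        Real.log (f x) + δ * Real.log (f m) := by field_simp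
    rw [e] at h4
    nlinarith
  calc f x = Real.exp (Real.log (f x)) := (Real.exp_log hx).symm
    _ ≤ Real.exp (Real.log (f q) + δ * (Real.log (f q) - a)) := Real.exp_le_exp.2 h3
    _ = _ := by rw [Real.exp_add, Real.exp_log hq0]

/-- Invert `1 + x + x²/2 ≤ exp x` and use `(1 + x + x²/2)(1 - x + x²/2) = 1 + x⁴/4`. -/
lemma exp_neg_le_quadratic {x : ℝ} (hx : 0 ≤ x) : Real.exp (-x) ≤ 1 - x + x ^ 2 / 2 := by
  have h1 := Real.quadratic_le_exp_of_nonneg hx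
  have h2 : 0 < 1 + x + x ^ 2 / 2 := by positivity
  rw [Real.exp_neg]
  refine (inv_anti₀ h2 h1).trans ?_
  rw [inv_le_iff_one_le_mul₀ h2]
  nlinarith [sq_nonneg (x ^ 2)]

/-- The perimeter of a convex body with respect to an isotropic log-concave probability
measure. -/
theorem IsIsotropicLogConcaveProb.muPerimeter_le {n : ℕ}
    {μ : Measure (EuclideanSpace ℝ (Fin n))} (hμ : IsIsotropicLogConcaveProb μ)
    {A : Set (EuclideanSpace ℝ (Fin n))} (hA : IsFullConvexBody A) :
    muPerimeter μ A ≤ 4 * (n : ℝ≥0∞) := by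
  have := hμ.isProbabilityMeasure
  obtain ⟨f₀, -, hf₀, hlc, hμ₀⟩ := hμ.isLogConcave
  obtain ⟨f, hf, hae⟩ := exists_isRegularLogConcave_ae_eq volume hf₀ hlc
  have hμf : μ = volume.withDensity fun x => ENNReal.ofReal (f x) := by
    rw [hμ₀]
    exact withDensity_congr_ae (by filter_upwards [hae] with x hx; rw [hx])
  have hfm := hf.measurable
  have hne : A.Nonempty := hA.interior_nonempty.mono interior_subset
  obtain ⟨M, hM0, hfM, hψi, hψs, hκn⟩ := hf.exists_bound_potential hμf
  have hiso := hμ.isIsotropic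
  have hlow := fun m => hf.exp_le_of_norm_lt (EuclideanSpace.prekopaLeindler n) hμf
    hiso.memLp_inner hiso.integral_inner_eq_zero hiso.integral_inner_sq hfM hψi (m := m)
  rw [finrank_euclideanSpace_fin] at hκn
  set ψ : EuclideanSpace ℝ (Fin n) → ℝ := fun x => Real.log M - Real.log (f x) with hψ
  set κ := ∫ x, ψ x ∂μ with hκ
  set K := ∫ x, ψ x ^ 2 ∂μ with hK
  have hψm : Measurable ψ := by fun_prop
  have hψ0 : ∀ᵐ x ∂μ, 0 ≤ ψ x := by
    rw [hμf, ae_withDensity_iff (by fun_prop)]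
    refine .of_forall fun x hx => ?_
    have hx' : 0 < f x := by simpa using hx
    exact sub_nonneg.2 (Real.log_le_log hx' (hfM x))
  -- The factors come from the dilation, the lower bound near the origin, and the expansion of `E
  -- exp(-δψ)`; their slopes at zero are `n`, `2κ` and `-κ`.
  set Φ : ℝ → ℝ := fun δ => (1 + δ) ^ n * (Real.exp (2 * κ * δ) * (1 - δ * κ + δ ^ 2 * (K / 2)))
    with hΦ
  have hmass : ∀ δ, 0 < δ →
      ∫⁻ y, ENNReal.ofReal (f ((1 + δ)⁻¹ • y) *
        Real.exp (δ * (Real.log (f ((1 + δ)⁻¹ • y)) - (Real.log M - 2 * κ)))) ≤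
      ENNReal.ofReal (Φ δ) := by
    intro δ hδ
    have h1 : 0 < (1 + δ)⁻¹ := by positivity
    have e := lintegral_comp_homothety (ν := (volume : Measure (EuclideanSpace ℝ (Fin n))))
      (fun q => ENNReal.ofReal (f q * Real.exp (δ * (Real.log (f q) - (Real.log M - 2 * κ)))))
      h1 0
    simp only [add_zero, finrank_euclideanSpace_fin] at e
    rw [e, inv_pow, inv_inv]
    have e2 : ∫⁻ q, ENNReal.ofReal (f q * Real.exp (δ * (Real.log (f q) - (Real.log M - 2 * κ)))) =
        ∫⁻ q, ENNReal.ofReal (Real.exp (2 * κ * δ) * Real.exp (-(δ * ψ q))) ∂μ := by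
      rw [hμf, lintegral_withDensity_eq_lintegral_mul _ (by fun_prop) (by fun_prop)]
      refine lintegral_congr fun q => ?_
      simp only [Pi.mul_apply]
      rw [← ENNReal.ofReal_mul (hf.nonneg q), ← Real.exp_add]
      simp only [hψ]
      congr 3
      ring
    rw [e2, hΦ, ENNReal.ofReal_mul (by positivity)]
    gcongr
    have hqi : Integrable (fun q => 1 - δ * ψ q + δ ^ 2 / 2 * ψ q ^ 2) μ :=
      ((integrable_const _).sub (hψi.const_mul δ)).add (hψs.const_mul _)
    have hle : ∀ᵐ q ∂μ, Real.exp (-(δ * ψ q)) ≤ 1 - δ * ψ q + δ ^ 2 / 2 * ψ q ^ 2 := by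
      filter_upwards [hψ0] with q hq
      refine (exp_neg_le_quadratic (mul_nonneg hδ.le hq)).trans (le_of_eq (by ring))
    have e3 : ∫ q, (1 - δ * ψ q + δ ^ 2 / 2 * ψ q ^ 2) ∂μ = 1 - δ * κ + δ ^ 2 * (K / 2) := by
      have hs : Integrable (fun q => 1 - δ * ψ q) μ := (integrable_const _).sub (hψi.const_mul δ)
      rw [integral_add hs (hψs.const_mul _), integral_sub (integrable_const _) (hψi.const_mul δ),
        integral_const_mul, integral_const_mul]
      simp [hκ, hK]
      ring
    rw [← e3, ← integral_const_mul (Real.exp (2 * κ * δ)), ofReal_integral_eq_lintegral_ofReal (hqi.const_mul _)]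
    · refine lintegral_mono_ae ?_
      filter_upwards [hle] with q hq
      gcongr
    · filter_upwards [hle] with q hq
      exact mul_nonneg (Real.exp_pos _).le ((Real.exp_pos _).le.trans hq)
  -- The lower bound on `f` holds on the open ball of radius `1/2`, hence on closed balls of smaller
  -- radius `r`; the limit `r → 1/2` is taken at the end.
  have hbound : ∀ r, 0 < r → r < 1 / 2 → muPerimeter μ A ≤ ENNReal.ofReal ((n + κ) / r) := by
    intro r hr hr2
    have hshell : ∀ ε, 0 < ε →
        μ ((A + ε • Metric.closedBall (0 : EuclideanSpace ℝ (Fin n)) 1) \ A) / ENNReal.ofReal ε ≤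
        ENNReal.ofReal (ε⁻¹ * (Φ (ε / r) - 1)) := by
      intro ε hε
      have hδ : 0 < ε / r := by positivity
      have h1 := measure_univ_add_measure_shell_le hA.convex hA.isCompact hne
        (f := fun x => ENNReal.ofReal (f x)) (F := fun y => ENNReal.ofReal
          (f ((1 + ε / r)⁻¹ • y) * Real.exp (ε / r * (Real.log (f ((1 + ε / r)⁻¹ • y)) -
            (Real.log M - 2 * κ))))) (by fun_prop) hε.le (fun x y hxy =>
          ENNReal.ofReal_le_ofReal (hf.le_mul_exp_of_norm_sub_le hδ
            (fun m hm => hlow m (hm.trans_lt hr2)) (by rwa [mul_div_cancel₀ _ hr.ne']))) hμf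
      have h2 := h1.trans (hmass _ hδ)
      rw [measure_univ, add_comm] at h2
      have h3 := ENNReal.le_sub_of_add_le_right ENNReal.one_ne_top h2
      rw [← ENNReal.ofReal_one, ← ENNReal.ofReal_sub _ zero_le_one] at h3
      rw [ENNReal.ofReal_mul (by positivity), ENNReal.ofReal_inv_of_pos hε, div_eq_mul_inv,
        mul_comm]
      gcongr
    have hder : HasDerivAt (fun ε => Φ (ε / r)) ((n + κ) / r) 0 := by
      have hd : HasDerivAt Φ (n + κ) 0 := by
        have d1 : HasDerivAt (fun δ : ℝ => (1 + δ) ^ n) (n : ℝ) 0 := by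
          simpa using ((hasDerivAt_id (0 : ℝ)).const_add 1).fun_pow n
        have d2 : HasDerivAt (fun δ : ℝ => Real.exp (2 * κ * δ)) (2 * κ) 0 := by
          simpa using ((hasDerivAt_id (0 : ℝ)).const_mul (2 * κ)).exp
        have d3 : HasDerivAt (fun δ : ℝ => 1 - δ * κ + δ ^ 2 * (K / 2)) (-κ) 0 := by
          simpa using (((hasDerivAt_id (0 : ℝ)).mul_const κ).const_sub 1).fun_add
            (((hasDerivAt_id (0 : ℝ)).fun_pow 2).mul_const (K / 2))
        refine (d1.fun_mul (d2.fun_mul d3)).congr_deriv ?_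
        simp
        ring
      have hd' : HasDerivAt Φ (n + κ) (0 / r) := by rwa [zero_div]
      refine (hd'.comp 0 ((hasDerivAt_id (0 : ℝ)).div_const r)).congr_deriv ?_
      simp [div_eq_mul_inv]
    have hlim : Tendsto (fun ε => ENNReal.ofReal (ε⁻¹ * (Φ (ε / r) - 1))) (𝓝[>] 0)
        (𝓝 (ENNReal.ofReal ((n + κ) / r))) := by
      refine ENNReal.tendsto_ofReal ?_
      have h1 := (hasDerivAt_iff_tendsto_slope_zero.1 hder).mono_left
        (nhdsWithin_mono (0 : ℝ) (s := Ioi 0) fun x hx => ne_of_gt hx)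
      have hΦ0 : Φ 0 = 1 := by simp [hΦ]
      simpa [hΦ0] using h1
    rw [← hlim.liminf_eq]
    refine liminf_le_liminf ?_
    filter_upwards [self_mem_nhdsWithin] with ε hε using hshell ε hε
  have hlim : Tendsto (fun r : ℝ => ENNReal.ofReal ((n + κ) / r)) (𝓝[<] (1 / 2))
      (𝓝 (ENNReal.ofReal ((n + κ) / (1 / 2)))) := by
    refine ENNReal.tendsto_ofReal (Tendsto.mono_left ?_ nhdsWithin_le_nhds)
    exact tendsto_const_nhds.div tendsto_id (by norm_num)
  have hfin : muPerimeter μ A ≤ ENNReal.ofReal ((n + κ) / (1 / 2)) := by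
    refine ge_of_tendsto hlim ?_
    filter_upwards [Ioo_mem_nhdsLT (by norm_num : (0 : ℝ) < 1 / 2)] with r hr
    exact hbound r hr.1 hr.2
  refine hfin.trans ?_
  have h4 : (n + κ) / (1 / 2) ≤ 4 * (n : ℝ) := by linarith
  refine (ENNReal.ofReal_le_ofReal h4).trans (le_of_eq ?_)
  rw [ENNReal.ofReal_mul (by norm_num), ENNReal.ofReal_natCast, ENNReal.ofReal_ofNat]

theorem theorem1p2 (n : ℕ) :
    (∀ μ : Measure (EuclideanSpace ℝ (Fin n)), IsIsotropicLogConcaveProb μ →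
      ∀ A : Set (EuclideanSpace ℝ (Fin n)), IsSymmetricConvexBody A →
        muPerimeter μ A ≤ 4 * (n : ℝ≥0∞)) ∧
    symmMaxPerimeterConst n ≤ 4 * (n : ℝ≥0∞) := by
  have main : ∀ μ : Measure (EuclideanSpace ℝ (Fin n)), IsIsotropicLogConcaveProb μ →
      ∀ A : Set (EuclideanSpace ℝ (Fin n)), IsSymmetricConvexBody A →
        muPerimeter μ A ≤ 4 * (n : ℝ≥0∞) :=
    fun μ hμ A hA => hμ.muPerimeter_le hA.toIsFullConvexBody
  exact ⟨main, iSup₂_le fun μ hμ => iSup₂_le fun A hA => main μ hμ A hA⟩
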